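/- An inverse monoid is a monoid $S$ in which every $a$ has a unique inverse $a^{-1}$ (with $aa^{-1}a=a$, $a^{-1}aa^{-1}=a^{-1}$). Let $\sigma$ be its least congruence whose quotient is a group, and $\sigma^\sharp\colon S\to S/\sigma$ the projection; $S/\sigma$ is the greatest group image of $S$. $S$ is $E$-unitary if the preimage of $1$ under $\sigma^\sharp$ is the set of idempotents of $S$. A McAlister triple $(G,\mathcal Y,\mathcal X)$ consists of a group $G$ acting by order preserving maps on a poset $\mathcal X$, and an order ideal $\mathcal Y\subseteq\mathcal X$ which is a meet semilattice, such that $G\mathcal Y=\mathcal X$ and $g\mathcal Y\cap\mathcal Y\neq\emptyset$ for all $g\in G$. Its $P$-semigroup $P(G,\mathcal Y,\mathcal X)$ consists of all pairs $(y,g)$ with $g\in G$, $y\in g\mathcal Y\cap\mathcal Y$, with multiplication $(y,g)(z,h)=(y\wedge gz,gh)$, where $y\wedge gz$ is the greatest lower bound in $\mathcal X$ (which exists). Let $G$ be a group generated by a set $X$ via a (not necessarily injective) map $X\to G$. Its Cayley graph $\Gamma_X$ has vertex set $G$ and, for $g\in G$ and each letter $a\in X\cup X^{-1}$, an edge labelled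 $a$ from $g$ to $ga$, whose inverse is the edge labelled $a^{-1}$ from $ga$ to $g$. Subgraphs are closed under endpoints and inverse edges. Let $\operatorname{CSub}\Gamma_X$ be the poset of non-empty connected subgraphs under inclusion, with the left action of $G$. A closure operator $c\colon\Delta\mapsto\Delta^c$ on $\operatorname{CSub}\Gamma_X$ is $G$-invariant if $(g\Delta)^c=g(\Delta^c)$, and finitary if $\Delta^c$ is always the union of the $F^c$ with $F\subseteq\Delta$ finite (and connected). The graphs $F^c$ with $F$ finite are called compact. For $G$-invariant $c$ let $$S_c=\{(\Delta,g): g\in G,\ \Delta\in\operatorname{CSub}\Gamma_X \text{ compact},\ 1,g\in\Delta\},$$ $$(\Delta,g)(\Xi,h)=((\Delta\cup g\Xi)^c,gh),\qquad (\Delta,g)^{-1}=(g^{-1}\Delta,g^{-1}),$$ an inverse monoid with identity $(\{1\}^c,1)$. Let $\mathcal X_c$ be the set of compact graphs ordered by reverse inclusion, with the left action of $G$, and $\mathcal Y_c$ the set of those containing $1$. **Corollary (McAlister's $P$-theorem).** 1. Every $E$-unitary inverse monoid is isomorphic to the $P$-semigroup of some McAlister triple. 2. Let $S$ be an $E$-unitary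 inverse monoid generated by a set $X$ via a map $X\to S$, and let $\Gamma_X$ be the Cayley graph of $G=S/\sigma$, generated by $X$ via the composite map $X\to S\to G$. There is a $G$-invariant, finitary closure operator $c=c_S$ on $\operatorname{CSub}\Gamma_X$ whose closed elements are precisely those $\Delta$ such that, for all words $u,v$ over $X\cup X^{-1}$ with the same value in $S$ and all vertices $g,h$ of $\Delta$, $u$ labels a path from $g$ to $h$ in $\Delta$ if and only if $v$ does. For this $c$, the map $s\mapsto(S\Gamma(s),\sigma^\sharp(s))$ is an isomorphism $S\to S_c$, where $S\Gamma(s)$ is the image in $\Gamma_X$ under $\sigma^\sharp$ of the strong component of $s$ in the Cayley graph of $S$. Moreover $(G,\mathcal Y_c,\mathcal X_c)$ is a McAlister triple, and the same map is an isomorphism $S\to P(G,\mathcal Y_c,\mathcal X_c)$. 3. In general, for every group $G$ generated by a set $X$ via a map and every $G$-invariant, finitary closure operator $c$ on $\operatorname{CSub}\Gamma_X$, the inverse monoid $S_c$ is $E$-unitary, $(G,\mathcal Y_c,\mathcal X_c)$ is a McAlister triple, in which $\Delta\wedge\Xi=(\Delta\cup\Xi)^c$ for $\Delta,\Xi\in\mathcal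 Y_c$, and the identity map on pairs is an isomorphism $S_c\to P(G,\mathcal Y_c,\mathcal X_c)$. -/

import Mathlib

universe u v

/-! ### Inverse monoids and the greatest group image -/

/-- An inverse monoid: every `a` has a unique inverse `a⁻¹`, in the sense that `a * a⁻¹ * a = a`
and `a⁻¹ * a * a⁻¹ = a⁻¹`. -/
class InverseMonoid (S : Type*) extends Monoid S, Inv S where
  mul_inv_mul : ∀ a : S, a * a⁻¹ * a = a
  inv_mul_inv : ∀ a : S, a⁻¹ * a * a⁻¹ = a⁻¹
  eq_inv : ∀ a b : S, a * b * a = a → b * a * b = b → b = a⁻¹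

/-- In an inverse monoid, idempotents commute. -/
theorem InverseMonoid.idem_comm {S : Type*} [InverseMonoid S] {e f : S}
    (he : e * e = e) (hf : f * f = f) : e * f = f * e := by
  have self : ∀ {k : S}, k * k = k → k = k⁻¹ := fun {k} hk =>
    eq_inv k k (by rw [hk, hk]) (by rw [hk, hk])
  have key : ∀ {e f : S}, e * e = e → f * f = f → e * f * (e * f) = e * f := by
    intro e f he hf
    obtain ⟨x, hx⟩ : ∃ x, x = (e * f)⁻¹ := ⟨_, rfl⟩
    have h1 : e * f * x * (e * f) = e * f := hx ▸ mul_inv_mul (e * f)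
    have h2 : x * (e * f) * x = x := hx ▸ inv_mul_inv (e * f)
    have h3 : f * x * e = x := by
      rw [hx]
      rw [hx] at h1 h2
      apply eq_inv
      · calc e * f * (f * (e * f)⁻¹ * e) * (e * f)
            = e * (f * f) * (e * f)⁻¹ * ((e * e) * f) := by simp only [mul_assoc]
          _ = e * f := by rw [he, hf, h1]
      · calc f * (e * f)⁻¹ * e * (e * f) * (f * (e * f)⁻¹ * e)
            = f * ((e * f)⁻¹ * ((e * e) * (f * f)) * (e * f)⁻¹) * e := by simp only [mul_assoc]
          _ = f * (e * f)⁻¹ * e := by rw [he, hf, h2]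
    have h4 : x * x = x := by
      calc x * x = f * x * e * (f * x * e) := by rw [h3]
        _ = f * (x * (e * f) * x) * e := by simp only [mul_assoc]
        _ = x := by rw [h2, h3]
    have h5 : e * f = x := (eq_inv x (e * f) h2 h1).trans (self h4).symm
    rw [h5, h4]
  have hef := key he hf
  have hfe := key hf he
  have h : f * e = (e * f)⁻¹ := by
    apply eq_inv
    · calc e * f * (f * e) * (e * f) = e * (f * f) * ((e * e) * f) := by simp only [mul_assoc]
        _ = e * f := by rw [he, hf, hef]
    · calc f * e * (e * f) * (f * e) = f * (e * e) * ((f * f) * e) := by simp only [mul_assoc]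
        _ = f * e := by rw [he, hf, hfe]
  rw [h]
  exact self hef

/-- The least group congruence `σ`: the least congruence whose quotient is a group. -/
def minGroupCon (S : Type*) [InverseMonoid S] : Con S :=
  sInf {ρ : Con S | ∀ a, ∃ b, ρ (a * b) 1 ∧ ρ (b * a) 1}

theorem minGroupCon_iff {S : Type*} [InverseMonoid S] {a b : S} :
    minGroupCon S a b ↔ ∀ ρ : Con S, (∀ a, ∃ b, ρ (a * b) 1 ∧ ρ (b * a) 1) → ρ a b :=
  Iff.rfl

theorem minGroupCon_idem {S : Type*} [InverseMonoid S] {e : S} (he : e * e = e) :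
    minGroupCon S e 1 := by
  rw [minGroupCon_iff]
  intro ρ hρ
  obtain ⟨b, hb, -⟩ := hρ e
  have h1 : ρ (e * e * b) (e * 1) := by
    rw [mul_assoc]
    exact ρ.mul (ρ.refl e) hb
  rw [he, mul_one] at h1
  exact ρ.trans (ρ.symm h1) hb

theorem minGroupCon_mul_inv {S : Type*} [InverseMonoid S] (a : S) :
    minGroupCon S (a * a⁻¹) 1 :=
  minGroupCon_idem (by rw [← mul_assoc, InverseMonoid.mul_inv_mul])

theorem minGroupCon_inv_mul {S : Type*} [InverseMonoid S] (a : S) :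
    minGroupCon S (a⁻¹ * a) 1 :=
  minGroupCon_idem (by rw [← mul_assoc, InverseMonoid.inv_mul_inv])

theorem minGroupCon_inv {S : Type*} [InverseMonoid S] {a b : S} (h : minGroupCon S a b) :
    minGroupCon S a⁻¹ b⁻¹ := by
  have h1 : minGroupCon S (a⁻¹ * (b * b⁻¹)) (a⁻¹ * 1) :=
    (minGroupCon S).mul ((minGroupCon S).refl _) (minGroupCon_mul_inv b)
  have h2 : minGroupCon S (a⁻¹ * (a * b⁻¹)) (a⁻¹ * (b * b⁻¹)) :=
    (minGroupCon S).mul ((minGroupCon S).refl _) ((minGroupCon S).mul h ((minGroupCon S).refl _))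
  have h3 : minGroupCon S (a⁻¹ * a * b⁻¹) (1 * b⁻¹) :=
    (minGroupCon S).mul (minGroupCon_inv_mul a) ((minGroupCon S).refl _)
  rw [mul_one] at h1
  rw [one_mul, mul_assoc] at h3
  exact (minGroupCon S).trans ((minGroupCon S).symm ((minGroupCon S).trans h2 h1)) h3

/-- The greatest group image `S/σ`. -/
def GroupImage (S : Type*) [InverseMonoid S] : Type _ := (minGroupCon S).Quotient

instance (S : Type*) [InverseMonoid S] : Monoid (GroupImage S) :=
  inferInstanceAs (Monoid (minGroupCon S).Quotient)

/-- The natural projection `σ♯ : S → S/σ`. -/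
def toGroupImage (S : Type*) [InverseMonoid S] : S →* GroupImage S := (minGroupCon S).mk'

instance (S : Type*) [InverseMonoid S] : Group (GroupImage S) where
  inv := Quotient.map' (fun a => a⁻¹) (fun _ _ h => minGroupCon_inv h)
  inv_mul_cancel := by
    intro a
    induction a using Quotient.inductionOn' with
    | h a => exact (minGroupCon S).eq.2 (minGroupCon_inv_mul a)

/-- `S` is `E`-unitary: `σ♯` is idempotent pure, that is, the preimage of `1` under `σ♯` is the set
of idempotents. -/
def IsEUnitary (S : Type*) [InverseMonoid S] : Prop :=
  ∀ s : S, toGroupImage S s = 1 ↔ s * s = s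

/-! ### Generators and words -/

/-- `M` (a group or an inverse monoid) is `X`-generated via `ι`. -/
def IsGeneratedBy {X M : Type*} [Monoid M] [Inv M] (ι : X → M) : Prop :=
  ∀ T : Submonoid M, (∀ x, ι x ∈ T) → (∀ a ∈ T, a⁻¹ ∈ T) → T = ⊤

/-- The value in `M` of a letter in `X ∪ X⁻¹`; the letter `(x, true)` is `x` and `(x, false)` is
the formal inverse `x⁻¹`. -/
def letterVal {X M : Type*} [Inv M] (ι : X → M) (a : X × Bool) : M :=
  cond a.2 (ι a.1) (ι a.1)⁻¹

/-- The value in `M` of a word over `X ∪ X⁻¹`. -/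
def wordVal {X M : Type*} [Monoid M] [Inv M] (ι : X → M) (w : List (X × Bool)) : M :=
  (w.map (letterVal ι)).prod

/-- The formal inverse of a letter. -/
def letterInv {X : Type*} (a : X × Bool) : X × Bool := (a.1, !a.2)

theorem letterInv_letterInv {X : Type*} (a : X × Bool) : letterInv (letterInv a) = a := by
  simp [letterInv]

theorem letterVal_letterInv {X G : Type*} [Group G] (ι : X → G) (a : X × Bool) :
    letterVal ι (letterInv a) = (letterVal ι a)⁻¹ := by
  rcases a with ⟨x, _ | _⟩ <;> simp [letterVal, letterInv]

/-! ### Subgraphs of the Cayley graph of a group -/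

/-- A subgraph of the Cayley graph of the group `G` with respect to `ι : X → G`.  The edge of the
Cayley graph labelled `a ∈ X ∪ X⁻¹` from `g` to `g * a` is written `(g, a)`; its inverse edge is
`(g * a, a⁻¹)`. -/
@[ext]
structure CayleySubgraph {X G : Type*} [Group G] (ι : X → G) where
  verts : Set G
  edges : Set (G × (X × Bool))
  source_mem : ∀ g a, (g, a) ∈ edges → g ∈ verts
  target_mem : ∀ g a, (g, a) ∈ edges → g * letterVal ι a ∈ verts
  inv_mem : ∀ g a, (g, a) ∈ edges → (g * letterVal ι a, letterInv a) ∈ edges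

namespace CayleySubgraph

variable {X G : Type*} [Group G] {ι : X → G}

/-- Inclusion of subgraphs. -/
instance : PartialOrder (CayleySubgraph ι) where
  le Δ Ξ := Δ.verts ⊆ Ξ.verts ∧ Δ.edges ⊆ Ξ.edges
  le_refl _ := ⟨subset_rfl, subset_rfl⟩
  le_trans _ _ _ h k := ⟨h.1.trans k.1, h.2.trans k.2⟩
  le_antisymm _ _ h k := CayleySubgraph.ext (h.1.antisymm k.1) (h.2.antisymm k.2)

/-- Union of subgraphs. -/
def union (Δ Ξ : CayleySubgraph ι) : CayleySubgraph ι where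
  verts := Δ.verts ∪ Ξ.verts
  edges := Δ.edges ∪ Ξ.edges
  source_mem g a h := h.imp (Δ.source_mem g a) (Ξ.source_mem g a)
  target_mem g a h := h.imp (Δ.target_mem g a) (Ξ.target_mem g a)
  inv_mem g a h := h.imp (Δ.inv_mem g a) (Ξ.inv_mem g a)

/-- The left translate `gΔ`: its vertices are the `g * h` with `h` a vertex of `Δ`, and its edges
the `(g * h, a)` with `(h, a)` an edge of `Δ`. -/
def translate (g : G) (Δ : CayleySubgraph ι) : CayleySubgraph ι where
  verts := {h | g⁻¹ * h ∈ Δ.verts}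
  edges := {e | (g⁻¹ * e.1, e.2) ∈ Δ.edges}
  source_mem h a he := Δ.source_mem _ _ he
  target_mem h a he := by
    have := Δ.target_mem _ _ he
    rwa [mul_assoc] at this
  inv_mem h a he := by
    have := Δ.inv_mem _ _ he
    rwa [mul_assoc] at this

/-- `Δ.IsPath g w h`: the path labelled `w` that starts at `g` lies in `Δ` and ends at `h`. -/
def IsPath (Δ : CayleySubgraph ι) : G → List (X × Bool) → G → Prop
  | g, [], h => g ∈ Δ.verts ∧ g = h
  | g, a :: w, h => (g, a) ∈ Δ.edges ∧ Δ.IsPath (g * letterVal ι a) w h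

/-- Connected (in particular non-empty) subgraphs. -/
def IsConnected (Δ : CayleySubgraph ι) : Prop :=
  Δ.verts.Nonempty ∧ ∀ g ∈ Δ.verts, ∀ h ∈ Δ.verts, ∃ w, Δ.IsPath g w h

/-- Finite subgraphs. -/
def IsFinite (Δ : CayleySubgraph ι) : Prop := Δ.verts.Finite ∧ Δ.edges.Finite

theorem IsPath.mono {Δ Ξ : CayleySubgraph ι} (hle : Δ ≤ Ξ) {w : List (X × Bool)} :
    ∀ {g h : G}, Δ.IsPath g w h → Ξ.IsPath g w h := by
  induction w with
  | nil => exact fun hp => ⟨hle.1 hp.1, hp.2⟩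
  | cons a w ih => exact fun hp => ⟨hle.2 hp.1, ih hp.2⟩

theorem IsPath.append {Δ : CayleySubgraph ι} {w w' : List (X × Bool)} :
    ∀ {g h k : G}, Δ.IsPath g w h → Δ.IsPath h w' k → Δ.IsPath g (w ++ w') k := by
  induction w with
  | nil => rintro g h k ⟨-, rfl⟩ hk; exact hk
  | cons a w ih => exact fun hp hk => ⟨hp.1, ih hp.2 hk⟩

theorem IsPath.translate {Δ : CayleySubgraph ι} (x : G) {w : List (X × Bool)} :
    ∀ {g h : G}, Δ.IsPath g w h → (Δ.translate x).IsPath (x * g) w (x * h) := by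
  induction w with
  | nil => rintro g h ⟨hg, rfl⟩; exact ⟨by simpa [CayleySubgraph.translate] using hg, rfl⟩
  | cons a w ih =>
    intro g h hp
    refine ⟨by simpa [CayleySubgraph.translate] using hp.1, ?_⟩
    rw [mul_assoc]
    exact ih hp.2

theorem le_union_left (Δ Ξ : CayleySubgraph ι) : Δ ≤ Δ.union Ξ :=
  ⟨Set.subset_union_left, Set.subset_union_left⟩

theorem le_union_right (Δ Ξ : CayleySubgraph ι) : Ξ ≤ Δ.union Ξ :=
  ⟨Set.subset_union_right, Set.subset_union_right⟩

theorem union_le {Δ Ξ Ω : CayleySubgraph ι} (h : Δ ≤ Ω) (k : Ξ ≤ Ω) : Δ.union Ξ ≤ Ω :=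
  ⟨Set.union_subset h.1 k.1, Set.union_subset h.2 k.2⟩

theorem isConnected_of_vertex {Δ : CayleySubgraph ι} {v : G} (hv : v ∈ Δ.verts)
    (h1 : ∀ g ∈ Δ.verts, ∃ w, Δ.IsPath g w v) (h2 : ∀ g ∈ Δ.verts, ∃ w, Δ.IsPath v w g) :
    Δ.IsConnected := by
  refine ⟨⟨v, hv⟩, fun g hg h hh => ?_⟩
  obtain ⟨w, hw⟩ := h1 g hg
  obtain ⟨w', hw'⟩ := h2 h hh
  exact ⟨_, hw.append hw'⟩

theorem IsConnected.union {Δ Ξ : CayleySubgraph ι} (hΔ : Δ.IsConnected) (hΞ : Ξ.IsConnected)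
    {v : G} (h1 : v ∈ Δ.verts) (h2 : v ∈ Ξ.verts) : (Δ.union Ξ).IsConnected := by
  refine isConnected_of_vertex (v := v) (Or.inl h1) ?_ ?_
  · rintro g (hg | hg)
    · exact (hΔ.2 g hg v h1).imp fun _ => IsPath.mono (le_union_left Δ Ξ)
    · exact (hΞ.2 g hg v h2).imp fun _ => IsPath.mono (le_union_right Δ Ξ)
  · rintro g (hg | hg)
    · exact (hΔ.2 v h1 g hg).imp fun _ => IsPath.mono (le_union_left Δ Ξ)
    · exact (hΞ.2 v h2 g hg).imp fun _ => IsPath.mono (le_union_right Δ Ξ)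

theorem IsConnected.translate {Δ : CayleySubgraph ι} (hΔ : Δ.IsConnected) (x : G) :
    (Δ.translate x).IsConnected := by
  obtain ⟨v, hv⟩ := hΔ.1
  refine ⟨⟨x * v, by simpa [CayleySubgraph.translate] using hv⟩, fun g hg h hh => ?_⟩
  obtain ⟨w, hw⟩ := hΔ.2 _ hg _ hh
  exact ⟨w, by simpa using hw.translate x⟩

theorem IsFinite.union {Δ Ξ : CayleySubgraph ι} (hΔ : Δ.IsFinite) (hΞ : Ξ.IsFinite) :
    (Δ.union Ξ).IsFinite := ⟨hΔ.1.union hΞ.1, hΔ.2.union hΞ.2⟩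

theorem IsFinite.translate {Δ : CayleySubgraph ι} (hΔ : Δ.IsFinite) (x : G) :
    (Δ.translate x).IsFinite := by
  refine ⟨hΔ.1.preimage (mul_right_injective x⁻¹).injOn, hΔ.2.preimage (Function.Injective.injOn ?_)⟩
  rintro ⟨g, a⟩ ⟨h, b⟩ hgh
  simpa using hgh

/-- The subgraph consisting of the edge `(g, a)`, its inverse and its endpoints. -/
def edgeGraph (ι : X → G) (g : G) (a : X × Bool) : CayleySubgraph ι where
  verts := {g, g * letterVal ι a}
  edges := {(g, a), (g * letterVal ι a, letterInv a)}
  source_mem := by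
    rintro h b (hb | hb) <;> simp only [Set.mem_singleton_iff, Prod.mk.injEq] at hb <;>
      obtain ⟨rfl, rfl⟩ := hb <;> simp
  target_mem := by
    rintro h b (hb | hb) <;> simp only [Set.mem_singleton_iff, Prod.mk.injEq] at hb <;>
      obtain ⟨rfl, rfl⟩ := hb <;> simp [letterVal_letterInv]
  inv_mem := by
    rintro h b (hb | hb) <;> simp only [Set.mem_singleton_iff, Prod.mk.injEq] at hb <;>
      obtain ⟨rfl, rfl⟩ := hb <;> simp [letterVal_letterInv, letterInv_letterInv]

theorem edgeGraph_isFinite (g : G) (a : X × Bool) : (edgeGraph ι g a).IsFinite :=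
  ⟨Set.toFinite {g, g * letterVal ι a}, Set.toFinite {(g, a), (g * letterVal ι a, letterInv a)}⟩

theorem edgeGraph_isConnected (g : G) (a : X × Bool) : (edgeGraph ι g a).IsConnected := by
  have hg : g ∈ (edgeGraph ι g a).verts := Or.inl rfl
  have hga : g * letterVal ι a ∈ (edgeGraph ι g a).verts := Or.inr rfl
  refine isConnected_of_vertex hg ?_ ?_
  · rintro h (rfl | rfl)
    · exact ⟨[], hg, rfl⟩
    · exact ⟨[letterInv a], Or.inr rfl, by simpa [letterVal_letterInv] using hg,
        by simp [letterVal_letterInv]⟩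
  · rintro h (rfl | rfl)
    · exact ⟨[], hg, rfl⟩
    · exact ⟨[a], Or.inl rfl, hga, rfl⟩

theorem edgeGraph_le {Δ : CayleySubgraph ι} {g : G} {a : X × Bool} (h : (g, a) ∈ Δ.edges) :
    edgeGraph ι g a ≤ Δ := by
  constructor
  · rintro k (rfl | rfl)
    exacts [Δ.source_mem _ _ h, Δ.target_mem _ _ h]
  · rintro k (rfl | rfl)
    exacts [h, Δ.inv_mem _ _ h]

theorem exists_finite_of_path {Δ : CayleySubgraph ι} {w : List (X × Bool)} :
    ∀ {g h : G} (F : CayleySubgraph ι), F.IsFinite → F.IsConnected → F ≤ Δ → g ∈ F.verts →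
      Δ.IsPath g w h →
      ∃ F' : CayleySubgraph ι, F'.IsFinite ∧ F'.IsConnected ∧ F ≤ F' ∧ F' ≤ Δ ∧ h ∈ F'.verts := by
  induction w with
  | nil => rintro g h F h1 h2 h3 h4 ⟨-, rfl⟩; exact ⟨F, h1, h2, le_rfl, h3, h4⟩
  | cons a w ih =>
    intro g h F h1 h2 h3 h4 hp
    obtain ⟨F', k1, k2, k3, k4, k5⟩ := ih (F.union (edgeGraph ι g a))
      (h1.union (edgeGraph_isFinite g a)) (h2.union (edgeGraph_isConnected g a) h4 (Or.inl rfl))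
      (union_le h3 (edgeGraph_le hp.1)) (Or.inr (Or.inr rfl)) hp.2
    exact ⟨F', k1, k2, (le_union_left _ _).trans k3, k4, k5⟩

end CayleySubgraph

/-- `CSub Γ_X`: the connected subgraphs of the Cayley graph, ordered by inclusion. -/
abbrev CSub {X G : Type*} [Group G] (ι : X → G) : Type _ :=
  {Δ : CayleySubgraph ι // Δ.IsConnected}

namespace CSub

variable {X G : Type*} [Group G] {ι : X → G}

/-- The left action of `G` on `CSub Γ_X`. -/
instance : MulAction G (CSub ι) where
  smul g Δ := ⟨Δ.1.translate g, Δ.2.translate g⟩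
  one_smul Δ := by
    apply Subtype.ext
    change Δ.1.translate 1 = Δ.1
    simp [CayleySubgraph.translate]
  mul_smul g h Δ := by
    apply Subtype.ext
    change Δ.1.translate (g * h) = (Δ.1.translate h).translate g
    simp [CayleySubgraph.translate, mul_assoc]

/-- The union of two connected subgraphs with a common vertex `v`. -/
def union (Δ Ξ : CSub ι) (v : G) (h1 : v ∈ Δ.1.verts) (h2 : v ∈ Ξ.1.verts) : CSub ι :=
  ⟨Δ.1.union Ξ.1, Δ.2.union Ξ.2 h1 h2⟩

theorem mem_smul {g h : G} {Δ : CSub ι} : h ∈ (g • Δ).1.verts ↔ g⁻¹ * h ∈ Δ.1.verts := Iff.rfl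

theorem smul_le {g : G} {Δ Ξ : CSub ι} (h : Δ ≤ Ξ) : g • Δ ≤ g • Ξ :=
  ⟨fun _ hk => h.1 hk, fun _ hk => h.2 hk⟩

theorem smul_le_iff {g : G} {Δ Ξ : CSub ι} : g • Δ ≤ Ξ ↔ Δ ≤ g⁻¹ • Ξ :=
  ⟨fun h => by simpa using smul_le (g := g⁻¹) h, fun h => by simpa using smul_le (g := g) h⟩

theorem left_le (Δ Ξ : CSub ι) (v : G) (h1 : v ∈ Δ.1.verts) (h2 : v ∈ Ξ.1.verts) :
    Δ ≤ Δ.union Ξ v h1 h2 := CayleySubgraph.le_union_left _ _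

theorem right_le (Δ Ξ : CSub ι) (v : G) (h1 : v ∈ Δ.1.verts) (h2 : v ∈ Ξ.1.verts) :
    Ξ ≤ Δ.union Ξ v h1 h2 := CayleySubgraph.le_union_right _ _

theorem union_le {Δ Ξ Ω : CSub ι} {v : G} {h1 : v ∈ Δ.1.verts} {h2 : v ∈ Ξ.1.verts}
    (h : Δ ≤ Ω) (k : Ξ ≤ Ω) : Δ.union Ξ v h1 h2 ≤ Ω := CayleySubgraph.union_le h k

/-- The subgraph with the single vertex `1` and no edges. -/
def single (ι : X → G) : CSub ι :=
  ⟨⟨{1}, ∅, by simp, by simp, by simp⟩, ⟨1, rfl⟩, by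
    rintro g rfl h rfl
    exact ⟨[], rfl, rfl⟩⟩

theorem single_le {Δ : CSub ι} (h : 1 ∈ Δ.1.verts) : single ι ≤ Δ :=
  ⟨fun k hk => by obtain rfl : k = 1 := hk; exact h, fun _ hk => hk.elim⟩

end CSub

/-! ### Closure operators on `CSub Γ_X` -/

section Closure

variable {X G : Type*} [Group G] {ι : X → G}

/-- `G`-invariant closure operators. -/
def GInvariant (c : ClosureOperator (CSub ι)) : Prop :=
  ∀ (g : G) (Δ : CSub ι), c (g • Δ) = g • c Δ

/-- Finitary closure operators: `Δᶜ` is the union of all `Fᶜ` with `F ⊆ Δ` finite. -/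
def IsFinitary (c : ClosureOperator (CSub ι)) : Prop :=
  ∀ Δ : CSub ι,
    (c Δ).1.verts = ⋃ F ∈ {F : CSub ι | F.1.IsFinite ∧ F ≤ Δ}, (c F).1.verts ∧
    (c Δ).1.edges = ⋃ F ∈ {F : CSub ι | F.1.IsFinite ∧ F ≤ Δ}, (c F).1.edges

/-- Compact subgraphs: the closures of finite connected subgraphs. -/
def IsCompactGraph (c : ClosureOperator (CSub ι)) (Δ : CSub ι) : Prop :=
  ∃ F : CSub ι, F.1.IsFinite ∧ c F = Δ

variable {c : ClosureOperator (CSub ι)}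

theorem IsCompactGraph.closed {Δ : CSub ι} (h : IsCompactGraph c Δ) : c Δ = Δ := by
  obtain ⟨F, -, rfl⟩ := h
  exact c.idempotent F

theorem IsCompactGraph.closure_le {Δ Ξ : CSub ι} (h : IsCompactGraph c Δ) (hle : Ξ ≤ Δ) :
    c Ξ ≤ Δ := by
  have := c.monotone hle
  rwa [h.closed] at this

theorem IsCompactGraph.exists_finite {Δ : CSub ι} (h : IsCompactGraph c Δ) {v : G}
    (hv : v ∈ Δ.1.verts) : ∃ F : CSub ι, F.1.IsFinite ∧ v ∈ F.1.verts ∧ c F = Δ := by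
  obtain ⟨F, hF, rfl⟩ := id h
  obtain ⟨g, hg⟩ := F.2.1
  obtain ⟨w, hw⟩ := (c F).2.2 g ((c.le_closure F).1 hg) v hv
  obtain ⟨F', k1, k2, k3, k4, k5⟩ :=
    CayleySubgraph.exists_finite_of_path F.1 hF F.2 (c.le_closure F) hg hw
  exact ⟨⟨F', k2⟩, k1, k5, le_antisymm (h.closure_le k4) (c.monotone k3)⟩

theorem IsCompactGraph.smul (hc : GInvariant c) {Δ : CSub ι} (h : IsCompactGraph c Δ) (g : G) :
    IsCompactGraph c (g • Δ) := by
  obtain ⟨F, hF, rfl⟩ := h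
  exact ⟨g • F, hF.translate g, hc g F⟩

theorem IsCompactGraph.union {Δ Ξ : CSub ι} (hΔ : IsCompactGraph c Δ) (hΞ : IsCompactGraph c Ξ)
    {v : G} (h1 : v ∈ Δ.1.verts) (h2 : v ∈ Ξ.1.verts) :
    IsCompactGraph c (c (Δ.union Ξ v h1 h2)) := by
  obtain ⟨F, hF, hvF, rfl⟩ := hΔ.exists_finite h1
  obtain ⟨K, hK, hvK, rfl⟩ := hΞ.exists_finite h2
  refine ⟨F.union K v hvF hvK, hF.union hK, le_antisymm (c.monotone ?_) ?_⟩
  · exact CSub.union_le ((c.le_closure F).trans (CSub.left_le _ _ _ _ _))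
      ((c.le_closure K).trans (CSub.right_le _ _ _ _ _))
  · refine IsCompactGraph.closure_le ⟨F.union K v hvF hvK, hF.union hK, rfl⟩ ?_
    exact CSub.union_le (c.monotone (CSub.left_le _ _ _ _ _))
      (c.monotone (CSub.right_le _ _ _ _ _))

end Closure

/-! ### The inverse monoid `S_c` -/

section Sc

variable {X G : Type*} [Group G] {ι : X → G}

/-- `S_c`: the pairs `(Δ, g)` where `Δ` is a compact connected subgraph containing `1` and `g`. -/
@[ext]
structure ClosureMonoid (c : ClosureOperator (CSub ι)) (hc : GInvariant c) where
  graph : CSub ι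
  elt : G
  compact : IsCompactGraph c graph
  one_mem : 1 ∈ graph.1.verts
  elt_mem : elt ∈ graph.1.verts

namespace ClosureMonoid

variable {c : ClosureOperator (CSub ι)} {hc : GInvariant c}

theorem mem_smul_graph (p q : ClosureMonoid c hc) : p.elt ∈ (p.elt • q.graph).1.verts := by
  simpa [CSub.mem_smul] using q.one_mem

/-- `(Δ, g)(Ξ, h) = ((Δ ∪ gΞ)ᶜ, gh)`. -/
instance : Mul (ClosureMonoid c hc) where
  mul p q :=
    { graph := c (p.graph.union (p.elt • q.graph) p.elt p.elt_mem (mem_smul_graph p q))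
      elt := p.elt * q.elt
      compact := p.compact.union (q.compact.smul hc _) _ _
      one_mem := (c.le_closure _).1 (Or.inl p.one_mem)
      elt_mem := (c.le_closure _).1 (Or.inr (by
        change p.elt⁻¹ * (p.elt * q.elt) ∈ q.graph.1.verts
        simpa using q.elt_mem)) }

/-- The identity element `({1}ᶜ, 1)`. -/
instance : One (ClosureMonoid c hc) where
  one :=
    { graph := c (CSub.single ι)
      elt := 1
      compact := ⟨CSub.single ι, ⟨Set.finite_singleton 1, Set.finite_empty⟩, rfl⟩
      one_mem := (c.le_closure _).1 rfl
      elt_mem := (c.le_closure _).1 rfl }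

/-- `(Δ, g)⁻¹ = (g⁻¹Δ, g⁻¹)`. -/
instance : Inv (ClosureMonoid c hc) where
  inv p :=
    { graph := p.elt⁻¹ • p.graph
      elt := p.elt⁻¹
      compact := p.compact.smul hc _
      one_mem := by simpa [CSub.mem_smul] using p.elt_mem
      elt_mem := by simpa [CSub.mem_smul] using p.one_mem }

theorem mul_elt (p q : ClosureMonoid c hc) : (p * q).elt = p.elt * q.elt := rfl
theorem one_elt : (1 : ClosureMonoid c hc).elt = 1 := rfl
theorem inv_elt (p : ClosureMonoid c hc) : p⁻¹.elt = p.elt⁻¹ := rfl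
theorem inv_graph (p : ClosureMonoid c hc) : p⁻¹.graph = p.elt⁻¹ • p.graph := rfl

theorem le_mul_left (p q : ClosureMonoid c hc) : p.graph ≤ (p * q).graph :=
  (CSub.left_le _ _ _ _ _).trans (c.le_closure _)

theorem le_mul_right (p q : ClosureMonoid c hc) : p.elt • q.graph ≤ (p * q).graph :=
  (CSub.right_le _ _ _ _ _).trans (c.le_closure _)

theorem mul_le {p q : ClosureMonoid c hc} {Ω : CSub ι} (hΩ : IsCompactGraph c Ω)
    (h : p.graph ≤ Ω) (k : p.elt • q.graph ≤ Ω) : (p * q).graph ≤ Ω :=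
  hΩ.closure_le (CSub.union_le h k)

theorem mul_le_iff {p q : ClosureMonoid c hc} {Ω : CSub ι} (hΩ : IsCompactGraph c Ω) :
    (p * q).graph ≤ Ω ↔ p.graph ≤ Ω ∧ p.elt • q.graph ≤ Ω :=
  ⟨fun h => ⟨(le_mul_left p q).trans h, (le_mul_right p q).trans h⟩, fun h => mul_le hΩ h.1 h.2⟩

theorem eq_of {p q : ClosureMonoid c hc} (h : p.elt = q.elt)
    (k : ∀ Ω, IsCompactGraph c Ω → (p.graph ≤ Ω ↔ q.graph ≤ Ω)) : p = q :=
  ClosureMonoid.ext (le_antisymm ((k _ q.compact).2 le_rfl) ((k _ p.compact).1 le_rfl)) h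

theorem graph_le_of_eq {p q : ClosureMonoid c hc} (h : p = q) : p.graph ≤ q.graph := h ▸ le_rfl

instance : InverseMonoid (ClosureMonoid c hc) where
  mul_assoc p q r := by
    refine eq_of (mul_assoc _ _ _) fun Ω hΩ => ?_
    rw [mul_le_iff hΩ, mul_le_iff hΩ, mul_le_iff hΩ, CSub.smul_le_iff (Δ := (q * r).graph),
      mul_le_iff (hΩ.smul hc _), ← CSub.smul_le_iff, ← CSub.smul_le_iff, mul_elt, mul_smul,
      and_assoc]
  one_mul p := by
    refine eq_of (one_mul _) fun Ω hΩ => ?_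
    rw [mul_le_iff hΩ, one_elt, one_smul]
    exact ⟨fun h => h.2, fun h => ⟨hΩ.closure_le (CSub.single_le (h.1 p.one_mem)), h⟩⟩
  mul_one p := by
    refine eq_of (mul_one _) fun Ω hΩ => ?_
    rw [mul_le_iff hΩ]
    refine ⟨fun h => h.1, fun h => ⟨h, ?_⟩⟩
    rw [CSub.smul_le_iff]
    refine (hΩ.smul hc _).closure_le (CSub.single_le ?_)
    simpa [CSub.mem_smul] using h.1 p.elt_mem
  mul_inv_mul p := by
    refine eq_of (by simp [mul_elt, inv_elt]) fun Ω hΩ => ?_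
    rw [mul_le_iff hΩ, mul_le_iff hΩ, inv_graph, mul_elt, inv_elt]
    simp
  inv_mul_inv p := by
    refine eq_of (by simp [mul_elt, inv_elt]) fun Ω hΩ => ?_
    rw [mul_le_iff hΩ, mul_le_iff hΩ, inv_graph, mul_elt, inv_elt]
    simp
  eq_inv p q h1 h2 := by
    have he : q.elt = p.elt⁻¹ := by
      have := congrArg ClosureMonoid.elt h1
      rw [mul_elt, mul_elt] at this
      exact eq_inv_of_mul_eq_one_right (mul_eq_right.1 this)
    refine ClosureMonoid.ext (le_antisymm ?_ ?_) he
    · rw [inv_graph, ← CSub.smul_le_iff]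
      exact (le_mul_right p q).trans ((le_mul_left _ _).trans (graph_le_of_eq h1))
    · rw [inv_graph, ← he]
      exact (le_mul_right q p).trans ((le_mul_left _ _).trans (graph_le_of_eq h2))

end ClosureMonoid

end Sc

/-! ### McAlister triples and `P`-semigroups -/

/-- `(G, 𝒴, 𝒳)` is a McAlister triple: `G` acts on the poset `𝒳` by order preserving maps, `𝒴` is an
order ideal of `𝒳` and a meet semilattice, `G𝒴 = 𝒳`, and `g𝒴` meets `𝒴` for every `g`. -/
structure IsMcAlisterTriple (G : Type*) {𝒳 : Type*} [Group G] [PartialOrder 𝒳] [MulAction G 𝒳]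
    (𝒴 : Set 𝒳) : Prop where
  smul_le_smul : ∀ (g : G) (x y : 𝒳), x ≤ y → g • x ≤ g • y
  isLowerSet : IsLowerSet 𝒴
  exists_meet : ∀ y z : 𝒴, ∃ m : 𝒴, IsGLB {y, z} m
  exists_smul_eq : ∀ x : 𝒳, ∃ (g : G), ∃ y ∈ 𝒴, g • y = x
  exists_smul_mem : ∀ g : G, ∃ y ∈ 𝒴, g • y ∈ 𝒴

/-- The `P`-semigroup `P(G, 𝒴, 𝒳)`: the pairs `(y, g)` with `y ∈ g𝒴 ∩ 𝒴`. -/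
@[ext]
structure PSemigroup {G 𝒳 : Type*} [Group G] [PartialOrder 𝒳] [MulAction G 𝒳] {𝒴 : Set 𝒳}
    (hT : IsMcAlisterTriple G 𝒴) where
  fst : 𝒳
  snd : G
  mem : fst ∈ ((fun y => snd • y) '' 𝒴) ∩ 𝒴

section PSemigroup

variable {G 𝒳 : Type*} [Group G] [PartialOrder 𝒳] [MulAction G 𝒳] {𝒴 : Set 𝒳}

theorem IsMcAlisterTriple.exists_isGLB (hT : IsMcAlisterTriple G 𝒴) (p q : PSemigroup hT) :
    ∃ m, IsGLB {p.fst, p.snd • q.fst} m := by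
  obtain ⟨⟨y, hy, hpy⟩, -⟩ := p.mem
  simp only at hpy
  obtain ⟨⟨m, hm⟩, hlb, hgr⟩ := hT.exists_meet ⟨y, hy⟩ ⟨q.fst, q.mem.2⟩
  have h1 : m ≤ y := hlb (Set.mem_insert _ _)
  have h2 : m ≤ q.fst := hlb (Set.mem_insert_of_mem _ rfl)
  refine ⟨p.snd • m, ?_, fun x hx => ?_⟩
  · rintro x (rfl | rfl)
    · rw [← hpy]; exact hT.smul_le_smul _ _ _ h1
    · exact hT.smul_le_smul _ _ _ h2
  · have k1 : p.snd⁻¹ • x ≤ y := by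
      have := hT.smul_le_smul p.snd⁻¹ _ _ (hx (Set.mem_insert _ _))
      rwa [← hpy, inv_smul_smul] at this
    have k2 : p.snd⁻¹ • x ≤ q.fst := by
      have := hT.smul_le_smul p.snd⁻¹ _ _ (hx (Set.mem_insert_of_mem _ rfl))
      rwa [inv_smul_smul] at this
    have k3 : (⟨p.snd⁻¹ • x, hT.isLowerSet k1 hy⟩ : 𝒴) ≤ ⟨m, hm⟩ := by
      apply hgr
      rintro z (rfl | rfl)
      exacts [k1, k2]
    have := hT.smul_le_smul p.snd _ _ (Subtype.coe_le_coe.2 k3)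
    rwa [smul_inv_smul] at this

/-- `(y, g)(z, h) = (y ∧ gz, gh)`, where `y ∧ gz` is the greatest lower bound in `𝒳`. -/
noncomputable instance (hT : IsMcAlisterTriple G 𝒴) : Mul (PSemigroup hT) where
  mul p q :=
    { fst := (hT.exists_isGLB p q).choose
      snd := p.snd * q.snd
      mem := by
        have hm := (hT.exists_isGLB p q).choose_spec
        have h1 := hm.1 (Set.mem_insert _ _)
        have h2 := hm.1 (Set.mem_insert_of_mem _ rfl)
        refine ⟨⟨(p.snd * q.snd)⁻¹ • (hT.exists_isGLB p q).choose, ?_, smul_inv_smul _ _⟩,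
          hT.isLowerSet h1 p.mem.2⟩
        obtain ⟨⟨z, hz, hqz⟩, -⟩ := q.mem
        have h3 := hT.smul_le_smul (p.snd * q.snd)⁻¹ _ _ h2
        have h4 : (p.snd * q.snd)⁻¹ • p.snd • q.fst = z := by
          rw [← hqz, mul_inv_rev, mul_smul, inv_smul_smul, inv_smul_smul]
        exact hT.isLowerSet (h3.trans_eq h4) hz }

end PSemigroup

/-! ### The triple of a closure operator -/

section Triple

variable {X G : Type*} [Group G] {ι : X → G}

/-- The poset `𝒳` of compact subgraphs, ordered by reverse inclusion. -/
@[ext]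
structure CompactGraphs (c : ClosureOperator (CSub ι)) (hc : GInvariant c) where
  graph : CSub ι
  compact : IsCompactGraph c graph

variable {c : ClosureOperator (CSub ι)} {hc : GInvariant c}

instance : PartialOrder (CompactGraphs c hc) where
  le Δ Ξ := Ξ.graph ≤ Δ.graph
  le_refl _ := le_refl _
  le_trans _ _ _ h k := le_trans k h
  le_antisymm _ _ h k := CompactGraphs.ext (le_antisymm k h)

instance : MulAction G (CompactGraphs c hc) where
  smul g Δ := ⟨g • Δ.graph, Δ.compact.smul hc g⟩
  one_smul Δ := CompactGraphs.ext (one_smul G Δ.graph)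
  mul_smul g h Δ := CompactGraphs.ext (mul_smul g h Δ.graph)

/-- The set `𝒴` of compact subgraphs containing `1`. -/
def compactGraphsOne (c : ClosureOperator (CSub ι)) (hc : GInvariant c) :
    Set (CompactGraphs c hc) :=
  {Δ | 1 ∈ Δ.graph.1.verts}

end Triple

/-! ### The closure operator and the Schützenberger graphs of an inverse monoid -/

section Schutzenberger

variable {X S : Type*} [InverseMonoid S]

/-- The generating map `σ♯ ∘ ι` of the greatest group image. -/
def groupGen (ι : X → S) : X → GroupImage S := fun x => toGroupImage S (ι x)

/-- The closed graphs that determine the closure operator `c_S`: whenever the words `u` and `v` have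
the same value in `S`, then `u` labels a path in `Δ` between given vertices if and only if `v`
does. -/
def IsClosedGraph (ι : X → S) (Δ : CSub (groupGen ι)) : Prop :=
  ∀ u v : List (X × Bool), wordVal ι u = wordVal ι v →
    ∀ g ∈ Δ.1.verts, ∀ h ∈ Δ.1.verts, Δ.1.IsPath g u h ↔ Δ.1.IsPath g v h

/-- `s` and `t` lie in the same strong component of the Cayley graph of `S`. -/
def SameComponent (ι : X → S) (s t : S) : Prop :=
  (∃ w, s * wordVal ι w = t) ∧ ∃ w, t * wordVal ι w = s

theorem toGroupImage_inv (s : S) : toGroupImage S s⁻¹ = (toGroupImage S s)⁻¹ := rfl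

theorem toGroupImage_letterVal (ι : X → S) (a : X × Bool) :
    toGroupImage S (letterVal ι a) = letterVal (groupGen ι) a := by
  rcases a with ⟨x, _ | _⟩ <;> rfl

theorem inverseMonoid_inv_inv (a : S) : a⁻¹⁻¹ = a :=
  (InverseMonoid.eq_inv a⁻¹ a (InverseMonoid.inv_mul_inv a) (InverseMonoid.mul_inv_mul a)).symm

theorem letterVal_letterInv' (ι : X → S) (a : X × Bool) :
    letterVal ι (letterInv a) = (letterVal ι a)⁻¹ := by
  rcases a with ⟨x, _ | _⟩ <;> simp [letterVal, letterInv, inverseMonoid_inv_inv]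

theorem mul_mul_inv_cancel_of {t a v : S} (h : t * a * v = t) : t * a * a⁻¹ = t := by
  obtain ⟨e, he⟩ : ∃ e, e = t⁻¹ * t := ⟨_, rfl⟩
  have hte : t * e = t := by rw [he, ← mul_assoc, InverseMonoid.mul_inv_mul]
  have hee : e * e = e := by
    rw [he, ← mul_assoc, InverseMonoid.inv_mul_inv]
  have haa : a * a⁻¹ * (a * a⁻¹) = a * a⁻¹ := by
    rw [← mul_assoc, InverseMonoid.mul_inv_mul]
  have heav : e * a * v = e := by
    rw [he, mul_assoc, mul_assoc, ← mul_assoc t, h]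
  have hcomm := InverseMonoid.idem_comm hee haa
  have h1 : a * a⁻¹ * e = e := by
    calc a * a⁻¹ * e = a * a⁻¹ * (e * a * v) := by rw [heav]
      _ = (a * a⁻¹ * e) * a * v := by simp only [mul_assoc]
      _ = e * (a * a⁻¹ * a) * v := by rw [← hcomm]; simp only [mul_assoc]
      _ = e := by rw [InverseMonoid.mul_inv_mul, heav]
  calc t * a * a⁻¹ = t * (e * (a * a⁻¹)) := by
        rw [← mul_assoc t e, hte, mul_assoc]
    _ = t := by rw [hcomm, h1, hte]

/-- The image in the Cayley graph of the greatest group image of the Schützenberger graph `SΓ(s)`,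
the strong component of `s` in the Cayley graph of `S`, under the map induced by `σ♯`. -/
def schutzenbergerGraph (ι : X → S) (s : S) : CayleySubgraph (groupGen ι) where
  verts := {g | ∃ t, SameComponent ι s t ∧ toGroupImage S t = g}
  edges := {e | ∃ t, SameComponent ι s t ∧ SameComponent ι s (t * letterVal ι e.2) ∧
    toGroupImage S t = e.1}
  source_mem := by
    rintro g a ⟨t, ht, -, rfl⟩
    exact ⟨t, ht, rfl⟩
  target_mem := by
    rintro g a ⟨t, -, ht, rfl⟩
    exact ⟨_, ht, by rw [map_mul, toGroupImage_letterVal]⟩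
  inv_mem := by
    rintro g a ⟨t, ht, ht', rfl⟩
    refine ⟨_, ht', ?_, by rw [map_mul, toGroupImage_letterVal]⟩
    obtain ⟨w, hw⟩ := ht'.2
    obtain ⟨w', hw'⟩ := ht.1
    have : t * letterVal ι a * (wordVal ι w * wordVal ι w') = t := by
      rw [← mul_assoc, hw, hw']
    simp only
    rw [letterVal_letterInv', mul_mul_inv_cancel_of this]
    exact ht

end Schutzenberger

/-!
Write `σ♯` for the projection of an inverse monoid `S` generated by `X` onto its greatest group
image. A graph `Ξ` that is closed, in the sense that words with the same value in `S` label the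
same paths in it, contains the translate `g • SΓ(s)` as soon as it contains the path that starts
at `g` and is labelled by some word with value `s`: the path can be prolonged by any detour inside
the strong component of `s` without changing its value in `S`.

`S` being `E`-unitary means that `σ♯` is injective on strong components, so every path in `SΓ(s)`
comes from a path in the Cayley graph of `S`. Hence `SΓ(s)` is itself closed, and `g • SΓ(s)` is the
closure of the path graph of any word with value `s`. As every finite connected graph is traversed
by a single path, the compact graphs are exactly these translates, which makes
`s ↦ (SΓ(s), σ♯(s))` surjective onto `S_c`. It is injective: if `SΓ(s) ≤ SΓ(t)` and
`σ♯(s) = σ♯(t)`, a path from `1` labelled by a word with value `s` lifts to one from `t * t⁻¹` to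
`t`, so `t * t⁻¹ * s = t`, that is, `t ≤ s` in the natural order.

For any closure operator `c`, the closure of a union is the meet for reverse inclusion, so the
products of `S_c` and of the `P`-semigroup of compact graphs are given by the same formula.
-/

/-! ### Inverse monoids -/

namespace InverseMonoid

/-- A group, regarded as an inverse monoid. It is not an instance, since the monoid structure of a
group would then be found along two paths. -/
abbrev ofGroup (G : Type*) [Group G] : InverseMonoid G where
  mul_inv_mul := by simp
  inv_mul_inv := by simp
  eq_inv a b h _ := eq_inv_of_mul_eq_one_right (mul_eq_right.1 h)

variable {S : Type*} [InverseMonoid S]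

theorem inv_one : (1 : S)⁻¹ = 1 :=
  (eq_inv 1 1 (by simp only [mul_one]) (by simp only [mul_one])).symm

theorem mul_inv_idem (s : S) : s * s⁻¹ * (s * s⁻¹) = s * s⁻¹ := by
  rw [← mul_assoc, mul_inv_mul]

theorem inv_mul_idem (s : S) : s⁻¹ * s * (s⁻¹ * s) = s⁻¹ * s := by
  rw [← mul_assoc, inv_mul_inv]

protected theorem mul_inv_rev (s t : S) : (s * t)⁻¹ = t⁻¹ * s⁻¹ := by
  have comm : t * t⁻¹ * (s⁻¹ * s) = s⁻¹ * s * (t * t⁻¹) :=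
    idem_comm (mul_inv_idem t) (inv_mul_idem s)
  refine (eq_inv _ _ ?_ ?_).symm
  · calc s * t * (t⁻¹ * s⁻¹) * (s * t)
        = s * (t * t⁻¹ * (s⁻¹ * s)) * t := by simp only [mul_assoc]
      _ = s * s⁻¹ * s * (t * t⁻¹ * t) := by rw [comm]; simp only [mul_assoc]
      _ = s * t := by rw [mul_inv_mul, mul_inv_mul]
  · calc t⁻¹ * s⁻¹ * (s * t) * (t⁻¹ * s⁻¹)
        = t⁻¹ * (s⁻¹ * s * (t * t⁻¹)) * s⁻¹ := by simp only [mul_assoc]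
      _ = t⁻¹ * t * t⁻¹ * (s⁻¹ * s * s⁻¹) := by rw [← comm]; simp only [mul_assoc]
      _ = t⁻¹ * s⁻¹ := by rw [inv_mul_inv, inv_mul_inv]

theorem mul_mul_inv_eq_of_mul_mul_eq {t a v : S} (h : t * a * v = t) :
    t * a * (t * a)⁻¹ = t * t⁻¹ := by
  rw [InverseMonoid.mul_inv_rev, ← mul_assoc, mul_mul_inv_cancel_of h]

theorem eq_of_mul_inv_mul_eq {s t : S} (hs : s * s⁻¹ * t = s) (ht : t * t⁻¹ * s = t) : s = t :=
  calc s = s * s⁻¹ * (t * t⁻¹ * s) := by rw [ht, hs]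
    _ = t * t⁻¹ * (s * s⁻¹ * s) := by
        rw [← mul_assoc, idem_comm (mul_inv_idem s) (mul_inv_idem t), mul_assoc]
    _ = t := by rw [mul_inv_mul, ht]

end InverseMonoid

theorem IsEUnitary.eq_of_mul_inv_eq {S : Type*} [InverseMonoid S] (hS : IsEUnitary S) {x y : S}
    (h : x * x⁻¹ = y * y⁻¹) (hσ : toGroupImage S x = toGroupImage S y) : x = y := by
  have hf : x⁻¹ * y * (x⁻¹ * y) = x⁻¹ * y :=
    (hS _).1 (by rw [map_mul, toGroupImage_inv, hσ, inv_mul_cancel])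
  have hg : y⁻¹ * x * (y⁻¹ * x) = y⁻¹ * x :=
    (hS _).1 (by rw [map_mul, toGroupImage_inv, hσ, inv_mul_cancel])
  have hxf : x * (x⁻¹ * y) = y := by rw [← mul_assoc, h, InverseMonoid.mul_inv_mul]
  have hyg : y * (y⁻¹ * x) = x := by rw [← mul_assoc, ← h, InverseMonoid.mul_inv_mul]
  have hxg : x * (y⁻¹ * x) = x := by
    nth_rw 1 [← hyg]
    rw [mul_assoc, hg, hyg]
  calc x = x * (x⁻¹ * y) * (y⁻¹ * x) := by rw [hxf, hyg]
    _ = x * (y⁻¹ * x) * (x⁻¹ * y) := by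
        rw [mul_assoc x, InverseMonoid.idem_comm hf hg, ← mul_assoc x]
    _ = y := by rw [hxg, hxf]

theorem IsEUnitary.of_monoidHom {S G : Type*} [InverseMonoid S] [Group G] (f : S →* G)
    (hf : ∀ s, f s = 1 → s * s = s) : IsEUnitary S := by
  refine fun s => ⟨fun h => hf s ?_, fun h => (minGroupCon S).eq.2 (minGroupCon_idem h)⟩
  have map_idem : ∀ {e : S}, e * e = e → f e = f 1 := fun he => by
    rw [map_one, ← mul_eq_left (a := f _), ← map_mul, he]
  have hs : Con.ker f s 1 := minGroupCon_iff.1 ((minGroupCon S).eq.1 h) (Con.ker f) fun a =>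
    ⟨a⁻¹, map_idem (InverseMonoid.mul_inv_idem a), map_idem (InverseMonoid.inv_mul_idem a)⟩
  exact Eq.trans hs (map_one f)

/-! ### Words -/

section Words

variable {X M S : Type*}

theorem wordVal_nil [Monoid M] [Inv M] (ι : X → M) : wordVal ι [] = 1 := rfl

theorem wordVal_cons [Monoid M] [Inv M] (ι : X → M) (a : X × Bool) (w : List (X × Bool)) :
    wordVal ι (a :: w) = letterVal ι a * wordVal ι w :=
  List.prod_cons

theorem wordVal_singleton [Monoid M] [Inv M] (ι : X → M) (a : X × Bool) :
    wordVal ι [a] = letterVal ι a :=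
  mul_one _

theorem wordVal_append [Monoid M] [Inv M] (ι : X → M) (w w' : List (X × Bool)) :
    wordVal ι (w ++ w') = wordVal ι w * wordVal ι w' := by
  rw [wordVal, List.map_append, List.prod_append, wordVal, wordVal]

variable [InverseMonoid S] {ι : X → S}

theorem wordVal_invRev (ι : X → S) (w : List (X × Bool)) :
    wordVal ι (FreeGroup.invRev w) = (wordVal ι w)⁻¹ := by
  induction w with
  | nil => exact InverseMonoid.inv_one.symm
  | cons a w ih =>
    have letter : wordVal ι (FreeGroup.invRev [a]) = (letterVal ι a)⁻¹ :=
      (wordVal_singleton ι _).trans (letterVal_letterInv' ι a)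
    rw [FreeGroup.invRev_cons, wordVal_append, ih, letter, wordVal_cons,
      InverseMonoid.mul_inv_rev]

theorem toGroupImage_wordVal (ι : X → S) (w : List (X × Bool)) :
    toGroupImage S (wordVal ι w) = wordVal (groupGen ι) w := by
  induction w with
  | nil => exact map_one _
  | cons a w ih => rw [wordVal_cons, wordVal_cons, map_mul, toGroupImage_letterVal, ih]

theorem IsGeneratedBy.exists_word (hι : IsGeneratedBy ι) (s : S) : ∃ w, wordVal ι w = s := by
  let values : Submonoid S :=
    { carrier := Set.range (wordVal ι)
      one_mem' := ⟨[], rfl⟩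
      mul_mem' := by
        rintro _ _ ⟨w, rfl⟩ ⟨w', rfl⟩
        exact ⟨w ++ w', wordVal_append ι w w'⟩ }
  have values_eq_top : values = ⊤ :=
    hι values (fun x => ⟨[(x, true)], wordVal_singleton ι _⟩)
      (by rintro _ ⟨w, rfl⟩; exact ⟨FreeGroup.invRev w, wordVal_invRev ι w⟩)
  exact values_eq_top.ge (Submonoid.mem_top s)

theorem IsGeneratedBy.groupGen (hι : IsGeneratedBy ι) : IsGeneratedBy (groupGen ι) := by
  intro T hT hinv
  have comap_eq_top : T.comap (toGroupImage S) = ⊤ := hι _ hT fun a ha => hinv _ ha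
  refine eq_top_iff.2 fun g _ => ?_
  obtain ⟨s, rfl⟩ := (minGroupCon S).mk'_surjective g
  exact comap_eq_top.ge (Submonoid.mem_top s)

end Words

/-! ### Path graphs -/

namespace CayleySubgraph

variable {X G : Type*} [Group G] {ι : X → G} {Δ : CayleySubgraph ι} {g h k : G}

theorem IsPath.eq_mul_wordVal {w : List (X × Bool)} (hw : Δ.IsPath g w h) :
    h = g * wordVal ι w := by
  induction w generalizing g with
  | nil => rw [wordVal_nil, mul_one, hw.2]
  | cons a w ih => rw [ih hw.2, wordVal_cons, mul_assoc]

theorem isPath_append_iff {w w' : List (X × Bool)} :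
    Δ.IsPath g (w ++ w') k ↔
      Δ.IsPath g w (g * wordVal ι w) ∧ Δ.IsPath (g * wordVal ι w) w' k := by
  refine ⟨fun hp => ?_, fun hp => hp.1.append hp.2⟩
  induction w generalizing g with
  | nil =>
    rw [wordVal_nil, mul_one]
    refine ⟨⟨?_, rfl⟩, hp⟩
    cases w' with
    | nil => exact hp.1
    | cons a w' => exact Δ.source_mem _ _ hp.1
  | cons a w ih =>
    rw [wordVal_cons, ← mul_assoc]
    exact ⟨⟨hp.1, (ih hp.2).1⟩, (ih hp.2).2⟩

/-- The subgraph spanned by the path labelled `w` that starts at `g`. -/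
def pathGraph (ι : X → G) : G → List (X × Bool) → CayleySubgraph ι
  | g, [] => (CSub.single ι).1.translate g
  | g, a :: w => (edgeGraph ι g a).union (pathGraph ι (g * letterVal ι a) w)

theorem pathGraph_le_iff {w : List (X × Bool)} :
    pathGraph ι g w ≤ Δ ↔ Δ.IsPath g w (g * wordVal ι w) := by
  induction w generalizing g with
  | nil =>
    rw [wordVal_nil, mul_one]
    refine ⟨fun hle => ⟨hle.1 (inv_mul_cancel g), rfl⟩,
      fun hp => ⟨fun h hh => ?_, fun _ => False.elim⟩⟩
    obtain rfl : g = h := inv_mul_eq_one.1 hh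
    exact hp.1
  | cons a w ih =>
    rw [wordVal_cons, ← mul_assoc]
    exact ⟨fun hle => ⟨((le_union_left _ _).trans hle).2 (Or.inl rfl),
        ih.1 ((le_union_right _ _).trans hle)⟩,
      fun hp => union_le (edgeGraph_le hp.1) (ih.2 hp.2)⟩

theorem isFinite_pathGraph (g : G) (w : List (X × Bool)) : (pathGraph ι g w).IsFinite := by
  induction w generalizing g with
  | nil => exact IsFinite.translate ⟨Set.finite_singleton 1, Set.finite_empty⟩ g
  | cons a w ih => exact (edgeGraph_isFinite g a).union (ih _)

theorem start_mem_pathGraph (g : G) (w : List (X × Bool)) : g ∈ (pathGraph ι g w).verts := by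
  cases w with
  | nil => exact inv_mul_cancel g
  | cons a w => exact Or.inl (Or.inl rfl)

theorem isConnected_pathGraph (g : G) (w : List (X × Bool)) : (pathGraph ι g w).IsConnected := by
  induction w generalizing g with
  | nil => exact (CSub.single ι).2.translate g
  | cons a w ih =>
    exact (edgeGraph_isConnected g a).union (ih _) (Or.inr rfl) (start_mem_pathGraph _ w)

theorem IsFinite.finite_Iic (hΔ : Δ.IsFinite) : (Set.Iic Δ).Finite := by
  refine Set.Finite.of_finite_image (f := fun Ξ => (Ξ.verts, Ξ.edges))
    ((hΔ.1.finite_subsets.prod hΔ.2.finite_subsets).subset ?_)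
    fun Ξ _ Ω _ h => CayleySubgraph.ext (congrArg Prod.fst h) (congrArg Prod.snd h)
  rintro _ ⟨Ξ, hΞ, rfl⟩
  exact hΞ

end CayleySubgraph

namespace CSub

variable {X G : Type*} [Group G] {ι : X → G} {Δ Ξ : CSub ι} {g : G} {w w' : List (X × Bool)}

/-- The path labelled `w` that starts at `g`, as a connected subgraph. -/
def pathGraph (ι : X → G) (g : G) (w : List (X × Bool)) : CSub ι :=
  ⟨CayleySubgraph.pathGraph ι g w, CayleySubgraph.isConnected_pathGraph g w⟩

theorem pathGraph_le_iff : pathGraph ι g w ≤ Δ ↔ Δ.1.IsPath g w (g * wordVal ι w) :=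
  CayleySubgraph.pathGraph_le_iff

theorem pathGraph_le_of_isPath {h : G} (hw : Δ.1.IsPath g w h) : pathGraph ι g w ≤ Δ :=
  pathGraph_le_iff.2 (hw.eq_mul_wordVal ▸ hw)

theorem pathGraph_nil_le_iff : pathGraph ι g [] ≤ Δ ↔ g ∈ Δ.1.verts :=
  pathGraph_le_iff.trans (and_iff_left (mul_one g).symm)

instance (Δ : CSub ι) : Nonempty {p : G × List (X × Bool) // pathGraph ι p.1 p.2 ≤ Δ} :=
  ⟨(Δ.2.1.some, []), pathGraph_nil_le_iff.2 Δ.2.1.some_mem⟩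

theorem pathGraph_append_le_iff :
    pathGraph ι g (w ++ w') ≤ Δ ↔
      pathGraph ι g w ≤ Δ ∧ pathGraph ι (g * wordVal ι w) w' ≤ Δ := by
  rw [pathGraph_le_iff, pathGraph_le_iff, pathGraph_le_iff, CayleySubgraph.isPath_append_iff,
    wordVal_append, mul_assoc]

theorem pathGraph_singleton_le_iff {a : X × Bool} :
    pathGraph ι g [a] ≤ Δ ↔ (g, a) ∈ Δ.1.edges := by
  rw [pathGraph_le_iff, wordVal_singleton]
  exact ⟨fun h => h.1, fun h => ⟨h, Δ.1.target_mem g a h, rfl⟩⟩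

theorem le_iff_forall_pathGraph_le :
    Δ ≤ Ξ ↔ ∀ g w, pathGraph ι g w ≤ Δ → pathGraph ι g w ≤ Ξ :=
  ⟨fun hle _ _ hw => hw.trans hle, fun H =>
    ⟨fun g hg => pathGraph_nil_le_iff.1 (H g [] (pathGraph_nil_le_iff.2 hg)),
      fun e he => pathGraph_singleton_le_iff.1 (H e.1 [e.2] (pathGraph_singleton_le_iff.2 he))⟩⟩

theorem start_mem_of_pathGraph_le (hw : pathGraph ι g w ≤ Δ) : g ∈ Δ.1.verts :=
  hw.1 (CayleySubgraph.start_mem_pathGraph g w)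

theorem end_mem_of_pathGraph_le (hw : pathGraph ι g w ≤ Δ) : g * wordVal ι w ∈ Δ.1.verts := by
  rw [← List.append_nil w] at hw
  exact start_mem_of_pathGraph_le (pathGraph_append_le_iff.1 hw).2

theorem exists_pathGraph_append_le {h : G} (hw : pathGraph ι g w ≤ Δ) (hh : h ∈ Δ.1.verts) :
    ∃ u, pathGraph ι g (w ++ u) ≤ Δ ∧ g * wordVal ι (w ++ u) = h := by
  obtain ⟨u, hu⟩ := Δ.2.2 _ (end_mem_of_pathGraph_le hw) h hh
  refine ⟨u, pathGraph_append_le_iff.2 ⟨hw, pathGraph_le_of_isPath hu⟩, ?_⟩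
  rw [wordVal_append, ← mul_assoc, hu.eq_mul_wordVal]

/-- In a finite graph, a path whose graph is maximal visits everything: otherwise it could be
continued to whatever it misses. -/
theorem exists_pathGraph_eq (hΔ : Δ.1.IsFinite) (hg : g ∈ Δ.1.verts) :
    ∃ w, pathGraph ι g w = Δ := by
  have finite_le : {Ξ | Ξ ≤ Δ ∧ ∃ w, pathGraph ι g w = Ξ}.Finite :=
    (hΔ.finite_Iic.preimage Subtype.val_injective.injOn).subset fun _ hΞ => hΞ.1
  obtain ⟨-, ⟨⟨hle, w, rfl⟩, hmax⟩⟩ :=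
    finite_le.exists_maximal ⟨_, pathGraph_nil_le_iff.2 hg, [], rfl⟩
  refine ⟨w, le_antisymm hle (le_iff_forall_pathGraph_le.2 fun h u hu => ?_)⟩
  obtain ⟨p, hp, rfl⟩ := exists_pathGraph_append_le hle (start_mem_of_pathGraph_le hu)
  have hpu : pathGraph ι g (w ++ p ++ u) ≤ Δ := pathGraph_append_le_iff.2 ⟨hp, hu⟩
  have extension : pathGraph ι g w ≤ pathGraph ι g (w ++ p ++ u) :=
    (pathGraph_append_le_iff.1 (pathGraph_append_le_iff.1 le_rfl).1).1
  exact (pathGraph_append_le_iff.1 le_rfl).2.trans (hmax ⟨hpu, _, rfl⟩ extension)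

theorem smul_pathGraph (x g : G) (w : List (X × Bool)) :
    x • pathGraph ι g w = pathGraph ι (x * g) w := by
  have pathGraph_le_smul : ∀ y h : G, pathGraph ι (y * h) w ≤ y • pathGraph ι h w := fun y h =>
    pathGraph_le_of_isPath ((pathGraph_le_iff.1 (le_refl (pathGraph ι h w))).translate y)
  refine le_antisymm (smul_le_iff.2 ?_) (pathGraph_le_smul x g)
  simpa only [inv_mul_cancel_left] using pathGraph_le_smul x⁻¹ (x * g)

theorem pathGraph_le_smul_iff {x : G} :
    pathGraph ι g w ≤ x • Δ ↔ pathGraph ι (x⁻¹ * g) w ≤ Δ := by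
  rw [← smul_pathGraph, smul_le_iff, inv_inv]

/-- The union of a directed family of connected subgraphs. -/
def directedUnion {κ : Type*} [Nonempty κ] (Φ : κ → CSub ι) (hΦ : Directed (· ≤ ·) Φ) :
    CSub ι where
  val :=
    { verts := ⋃ i, (Φ i).1.verts
      edges := ⋃ i, (Φ i).1.edges
      source_mem := fun g a h =>
        Set.mem_iUnion.2 ((Set.mem_iUnion.1 h).imp fun i => (Φ i).1.source_mem g a)
      target_mem := fun g a h =>
        Set.mem_iUnion.2 ((Set.mem_iUnion.1 h).imp fun i => (Φ i).1.target_mem g a)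
      inv_mem := fun g a h =>
        Set.mem_iUnion.2 ((Set.mem_iUnion.1 h).imp fun i => (Φ i).1.inv_mem g a) }
  property := by
    constructor
    · obtain ⟨g, hg⟩ := (Φ (Classical.arbitrary κ)).2.1
      exact ⟨g, Set.mem_iUnion_of_mem _ hg⟩
    · intro g hg h hh
      obtain ⟨i, hi⟩ := Set.mem_iUnion.1 hg
      obtain ⟨j, hj⟩ := Set.mem_iUnion.1 hh
      obtain ⟨k, hik, hjk⟩ := hΦ i j
      obtain ⟨w, hw⟩ := (Φ k).2.2 g (hik.1 hi) h (hjk.1 hj)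
      have hk : (Φ k).1.verts ⊆ ⋃ i, (Φ i).1.verts ∧ (Φ k).1.edges ⊆ ⋃ i, (Φ i).1.edges :=
        ⟨Set.subset_iUnion (fun i => (Φ i).1.verts) k,
          Set.subset_iUnion (fun i => (Φ i).1.edges) k⟩
      exact ⟨w, hw.mono hk⟩

section DirectedUnion

variable {κ : Type*} [Nonempty κ] {Φ : κ → CSub ι} {hΦ : Directed (· ≤ ·) Φ}

theorem le_directedUnion (i : κ) : Φ i ≤ directedUnion Φ hΦ :=
  ⟨Set.subset_iUnion (fun i => (Φ i).1.verts) i, Set.subset_iUnion (fun i => (Φ i).1.edges) i⟩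

theorem directedUnion_le (h : ∀ i, Φ i ≤ Δ) : directedUnion Φ hΦ ≤ Δ :=
  ⟨Set.iUnion_subset fun i => (h i).1, Set.iUnion_subset fun i => (h i).2⟩

theorem pathGraph_le_directedUnion_iff :
    pathGraph ι g w ≤ directedUnion Φ hΦ ↔ ∃ i, pathGraph ι g w ≤ Φ i := by
  refine ⟨fun hw => ?_, fun ⟨i, hi⟩ => hi.trans (le_directedUnion i)⟩
  induction w generalizing g with
  | nil =>
    obtain ⟨i, hi⟩ := Set.mem_iUnion.1 (start_mem_of_pathGraph_le hw)
    exact ⟨i, pathGraph_nil_le_iff.2 hi⟩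
  | cons a w ih =>
    rw [← List.singleton_append, pathGraph_append_le_iff, pathGraph_singleton_le_iff] at hw
    obtain ⟨i, hi⟩ := Set.mem_iUnion.1 hw.1
    obtain ⟨j, hj⟩ := ih hw.2
    obtain ⟨k, hik, hjk⟩ := hΦ i j
    exact ⟨k, pathGraph_append_le_iff (w := [a]).2
      ⟨(pathGraph_singleton_le_iff.2 hi).trans hik, hj.trans hjk⟩⟩

end DirectedUnion

end CSub

/-! ### Closure operators on connected subgraphs -/

section ClosureOperators

variable {X G : Type*} [Group G] {ι : X → G} {c : ClosureOperator (CSub ι)}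

theorem IsCompactGraph.exists_pathGraph {Δ : CSub ι} (hΔ : IsCompactGraph c Δ) {g : G}
    (hg : g ∈ Δ.1.verts) : ∃ w, c (CSub.pathGraph ι g w) = Δ := by
  obtain ⟨F, hF, hgF, rfl⟩ := hΔ.exists_finite hg
  obtain ⟨w, rfl⟩ := CSub.exists_pathGraph_eq hF hgF
  exact ⟨w, rfl⟩

theorem isCompactGraph_closure_pathGraph (g : G) (w : List (X × Bool)) :
    IsCompactGraph c (c (CSub.pathGraph ι g w)) :=
  ⟨_, CayleySubgraph.isFinite_pathGraph g w, rfl⟩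

theorem gInvariant_of_isClosed_smul
    (h : ∀ (g : G) (Δ : CSub ι), c.IsClosed Δ → c.IsClosed (g • Δ)) : GInvariant c := by
  refine fun g Δ => le_antisymm ?_ (CSub.smul_le_iff.2 ?_)
  · exact c.closure_min (CSub.smul_le (c.le_closure Δ)) (h g _ (c.isClosed_closure Δ))
  · exact c.closure_min (CSub.smul_le_iff.1 (c.le_closure (g • Δ)))
      (h g⁻¹ _ (c.isClosed_closure (g • Δ)))

theorem isFinitary_of_pathGraph_le_closure (h : ∀ {Δ : CSub ι} {g : G} {w : List (X × Bool)},
    CSub.pathGraph ι g w ≤ c Δ → ∃ F : CSub ι, F.1.IsFinite ∧ F ≤ Δ ∧ CSub.pathGraph ι g w ≤ c F) :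
    IsFinitary c := by
  refine fun Δ => ⟨Set.Subset.antisymm (fun g hg => ?_)
      (Set.iUnion₂_subset fun F hF => (c.monotone hF.2).1),
    Set.Subset.antisymm (fun e he => ?_) (Set.iUnion₂_subset fun F hF => (c.monotone hF.2).2)⟩
  · obtain ⟨F, hF, hle, hgF⟩ := h (CSub.pathGraph_nil_le_iff.2 hg)
    exact Set.mem_biUnion (x := F) ⟨hF, hle⟩ (CSub.pathGraph_nil_le_iff.1 hgF)
  · obtain ⟨F, hF, hle, heF⟩ := h (CSub.pathGraph_singleton_le_iff.2 he)
    exact Set.mem_biUnion (x := F) ⟨hF, hle⟩ (CSub.pathGraph_singleton_le_iff.1 heF)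

end ClosureOperators

/-! ### Schützenberger graphs -/

section SchutzenbergerGraphs

variable {X S : Type*} [InverseMonoid S] {ι : X → S} {s t : S}

theorem SameComponent.refl (ι : X → S) (s : S) : SameComponent ι s s :=
  ⟨⟨[], mul_one s⟩, ⟨[], mul_one s⟩⟩

theorem SameComponent.mul_inv_eq (h : SameComponent ι s t) : s * s⁻¹ = t * t⁻¹ := by
  obtain ⟨⟨w, rfl⟩, w', hw'⟩ := h
  exact (InverseMonoid.mul_mul_inv_eq_of_mul_mul_eq hw').symm

theorem SameComponent.mul_of_mul_mul {w w' : List (X × Bool)} (ht : SameComponent ι s t)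
    (h : SameComponent ι s (t * wordVal ι w * wordVal ι w')) :
    SameComponent ι s (t * wordVal ι w) := by
  obtain ⟨⟨p, rfl⟩, -⟩ := ht
  obtain ⟨-, q, hq⟩ := h
  exact ⟨⟨p ++ w, by rw [wordVal_append, mul_assoc]⟩,
    ⟨w' ++ q, by rw [wordVal_append, ← mul_assoc, hq]⟩⟩

theorem sameComponent_mul_inv (ι : X → S) (w : List (X × Bool)) :
    SameComponent ι (wordVal ι w) (wordVal ι w * (wordVal ι w)⁻¹) :=
  ⟨⟨FreeGroup.invRev w, by rw [wordVal_invRev]⟩, ⟨w, InverseMonoid.mul_inv_mul _⟩⟩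

theorem isPath_schutzenbergerGraph {w : List (X × Bool)} (ht : SameComponent ι s t)
    (htw : SameComponent ι s (t * wordVal ι w)) :
    (schutzenbergerGraph ι s).IsPath (toGroupImage S t) w (toGroupImage S (t * wordVal ι w)) := by
  induction w generalizing t with
  | nil =>
    rw [wordVal_nil, mul_one]
    exact ⟨⟨t, ht, rfl⟩, rfl⟩
  | cons a w ih =>
    rw [wordVal_cons, ← mul_assoc] at htw ⊢
    have hta : SameComponent ι s (t * letterVal ι a) := by
      rw [← wordVal_singleton] at htw ⊢
      exact ht.mul_of_mul_mul htw
    refine ⟨⟨t, ht, hta, rfl⟩, ?_⟩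
    rw [← toGroupImage_letterVal, ← map_mul]
    exact ih hta htw

/-- The image of the Schützenberger graph of `s`, as a connected subgraph of the Cayley graph of
the greatest group image. -/
def schutzenbergerCSub (ι : X → S) (s : S) : CSub (groupGen ι) where
  val := schutzenbergerGraph ι s
  property := by
    refine CayleySubgraph.isConnected_of_vertex (v := toGroupImage S s) ⟨s, .refl ι s, rfl⟩ ?_ ?_
    · rintro _ ⟨t, ht, rfl⟩
      obtain ⟨w, rfl⟩ := ht.2
      exact ⟨w, isPath_schutzenbergerGraph ht (.refl ι _)⟩
    · rintro _ ⟨t, ht, rfl⟩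
      obtain ⟨w, rfl⟩ := ht.1
      exact ⟨w, isPath_schutzenbergerGraph (.refl ι s) ht⟩

theorem pathGraph_le_schutzenbergerCSub {w : List (X × Bool)} (ht : SameComponent ι s t)
    (htw : SameComponent ι s (t * wordVal ι w)) :
    CSub.pathGraph (groupGen ι) (toGroupImage S t) w ≤ schutzenbergerCSub ι s :=
  CSub.pathGraph_le_of_isPath (isPath_schutzenbergerGraph ht htw)

/-- In the `E`-unitary case a path in the image of a Schützenberger graph can be lifted edge by
edge, because `σ♯` is injective on strong components. -/
theorem IsEUnitary.pathGraph_le_schutzenbergerCSub_iff (hS : IsEUnitary S) {g : GroupImage S}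
    {w : List (X × Bool)} :
    CSub.pathGraph (groupGen ι) g w ≤ schutzenbergerCSub ι s ↔
      ∃ t, toGroupImage S t = g ∧ SameComponent ι s t ∧ SameComponent ι s (t * wordVal ι w) := by
  refine ⟨fun hw => ?_, ?_⟩
  · induction w generalizing g with
    | nil =>
      obtain ⟨t, ht, rfl⟩ := CSub.start_mem_of_pathGraph_le hw
      exact ⟨t, rfl, ht, by rwa [wordVal_nil, mul_one]⟩
    | cons a w ih =>
      rw [← List.singleton_append, CSub.pathGraph_append_le_iff,
        CSub.pathGraph_singleton_le_iff] at hw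
      obtain ⟨⟨t, ht, hta, htg⟩, hw⟩ := hw
      obtain ⟨t', ht'g, ht', htw⟩ := ih hw
      obtain rfl : t * letterVal ι a = t' := by
        refine hS.eq_of_mul_inv_eq (hta.mul_inv_eq.symm.trans ht'.mul_inv_eq) ?_
        rw [ht'g, map_mul, htg, toGroupImage_letterVal, wordVal_singleton]
      exact ⟨t, htg, ht, by rwa [wordVal_cons, ← mul_assoc]⟩
  · rintro ⟨t, rfl, ht, htw⟩
    exact pathGraph_le_schutzenbergerCSub ht htw

theorem pathGraph_one_le_schutzenbergerCSub (ι : X → S) (w : List (X × Bool)) :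
    CSub.pathGraph (groupGen ι) 1 w ≤ schutzenbergerCSub ι (wordVal ι w) := by
  have h := pathGraph_le_schutzenbergerCSub (w := w) (sameComponent_mul_inv ι w)
    (by rw [InverseMonoid.mul_inv_mul]; exact .refl ι _)
  rwa [map_mul, toGroupImage_inv, mul_inv_cancel] at h

/-! ### Closed graphs -/

theorem isClosedGraph_iff {Δ : CSub (groupGen ι)} :
    IsClosedGraph ι Δ ↔ ∀ u v, wordVal ι u = wordVal ι v → ∀ g,
      CSub.pathGraph (groupGen ι) g u ≤ Δ → CSub.pathGraph (groupGen ι) g v ≤ Δ := by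
  constructor
  · intro hΔ u v huv g hu
    exact CSub.pathGraph_le_of_isPath ((hΔ u v huv g (CSub.start_mem_of_pathGraph_le hu) _
      (CSub.end_mem_of_pathGraph_le hu)).1 (CSub.pathGraph_le_iff.1 hu))
  · intro H
    have isPath_of_isPath : ∀ u v, wordVal ι u = wordVal ι v → ∀ g h,
        Δ.1.IsPath g u h → Δ.1.IsPath g v h := by
      intro u v huv g h hu
      have hv := CSub.pathGraph_le_iff.1 (H u v huv g (CSub.pathGraph_le_of_isPath hu))
      rwa [← toGroupImage_wordVal, ← huv, toGroupImage_wordVal, ← hu.eq_mul_wordVal] at hv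
    exact fun u v huv g _ h _ => ⟨isPath_of_isPath u v huv g h, isPath_of_isPath v u huv.symm g h⟩

variable {Ξ : CSub (groupGen ι)}

theorem IsClosedGraph.smul (hΞ : IsClosedGraph ι Ξ) (g : GroupImage S) :
    IsClosedGraph ι (g • Ξ) := by
  refine isClosedGraph_iff.2 fun u v huv h hu => ?_
  rw [CSub.pathGraph_le_smul_iff] at hu ⊢
  exact isClosedGraph_iff.1 hΞ u v huv _ hu

theorem isClosedGraph_directedUnion {κ : Type*} [Nonempty κ] {Φ : κ → CSub (groupGen ι)}
    {hdir : Directed (· ≤ ·) Φ} (hΦ : ∀ i, IsClosedGraph ι (Φ i)) :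
    IsClosedGraph ι (CSub.directedUnion Φ hdir) := by
  refine isClosedGraph_iff.2 fun u v huv g hu => ?_
  obtain ⟨i, hi⟩ := CSub.pathGraph_le_directedUnion_iff.1 hu
  exact CSub.pathGraph_le_directedUnion_iff.2 ⟨i, isClosedGraph_iff.1 (hΦ i) u v huv g hi⟩

theorem IsEUnitary.isClosedGraph_schutzenbergerCSub (hS : IsEUnitary S) (ι : X → S) (s : S) :
    IsClosedGraph ι (schutzenbergerCSub ι s) := by
  refine isClosedGraph_iff.2 fun u v huv g hu => ?_
  rw [hS.pathGraph_le_schutzenbergerCSub_iff] at hu ⊢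
  rwa [← huv]

/-- If `w` has value `s` and `p`, `q` are words leading from `s` to `t` and from `t * u` back to
`s`, then `w` and `w p u q` have the same value. -/
theorem IsClosedGraph.pathGraph_le_of_sameComponent (hΞ : IsClosedGraph ι Ξ)
    {w u : List (X × Bool)} {t : S} (hw : CSub.pathGraph (groupGen ι) 1 w ≤ Ξ)
    (ht : SameComponent ι (wordVal ι w) t)
    (htu : SameComponent ι (wordVal ι w) (t * wordVal ι u)) :
    CSub.pathGraph (groupGen ι) (toGroupImage S t) u ≤ Ξ := by
  obtain ⟨⟨p, rfl⟩, -⟩ := ht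
  obtain ⟨-, q, hq⟩ := htu
  have detour : wordVal ι w = wordVal ι (w ++ p ++ u ++ q) := by
    rw [wordVal_append, wordVal_append, wordVal_append, hq]
  have hle := isClosedGraph_iff.1 hΞ _ _ detour 1 hw
  have hu := (CSub.pathGraph_append_le_iff.1 (CSub.pathGraph_append_le_iff.1 hle).1).2
  rwa [one_mul, ← toGroupImage_wordVal, wordVal_append] at hu

theorem IsClosedGraph.schutzenbergerCSub_le_iff (hΞ : IsClosedGraph ι Ξ) {w : List (X × Bool)} :
    schutzenbergerCSub ι (wordVal ι w) ≤ Ξ ↔ CSub.pathGraph (groupGen ι) 1 w ≤ Ξ := by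
  refine ⟨(pathGraph_one_le_schutzenbergerCSub ι w).trans, fun hw => ⟨?_, ?_⟩⟩
  · rintro _ ⟨t, ht, rfl⟩
    exact CSub.start_mem_of_pathGraph_le
      (hΞ.pathGraph_le_of_sameComponent (u := []) hw ht (by rwa [wordVal_nil, mul_one]))
  · rintro ⟨_, a⟩ ⟨t, ht, hta, rfl⟩
    exact CSub.pathGraph_singleton_le_iff.1
      (hΞ.pathGraph_le_of_sameComponent hw ht (by rwa [wordVal_singleton]))

theorem IsClosedGraph.smul_schutzenbergerCSub_le_iff (hΞ : IsClosedGraph ι Ξ) {g : GroupImage S}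
    {w : List (X × Bool)} :
    g • schutzenbergerCSub ι (wordVal ι w) ≤ Ξ ↔ CSub.pathGraph (groupGen ι) g w ≤ Ξ := by
  rw [CSub.smul_le_iff, (hΞ.smul g⁻¹).schutzenbergerCSub_le_iff, CSub.pathGraph_le_smul_iff,
    inv_inv, mul_one]

end SchutzenbergerGraphs

/-! ### The closure operator of an `E`-unitary inverse monoid -/

section SchutzenbergerClosure

variable {X S : Type*} [InverseMonoid S] (hS : IsEUnitary S) {ι : X → S}

theorem IsEUnitary.directed_smul_schutzenbergerCSub (hS : IsEUnitary S) (Δ : CSub (groupGen ι)) :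
    Directed (· ≤ ·) fun p : {p : GroupImage S × List (X × Bool) //
        CSub.pathGraph (groupGen ι) p.1 p.2 ≤ Δ} =>
      p.1.1 • schutzenbergerCSub ι (wordVal ι p.1.2) := by
  rintro ⟨⟨g, w⟩, hw⟩ ⟨⟨h, u⟩, hu⟩
  obtain ⟨q, hq, rfl⟩ := CSub.exists_pathGraph_append_le hw (CSub.start_mem_of_pathGraph_le hu)
  have closed := (hS.isClosedGraph_schutzenbergerCSub ι (wordVal ι (w ++ q ++ u))).smul g
  have hle := CSub.pathGraph_append_le_iff.1 (closed.smul_schutzenbergerCSub_le_iff.1 le_rfl)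
  exact ⟨⟨(g, w ++ q ++ u), CSub.pathGraph_append_le_iff.2 ⟨hq, hu⟩⟩,
    closed.smul_schutzenbergerCSub_le_iff.2 (CSub.pathGraph_append_le_iff.1 hle.1).1,
    closed.smul_schutzenbergerCSub_le_iff.2 hle.2⟩

/-- The closure operator `c_S`: the closure of `Δ` is the union of the graphs `g • SΓ(s)`, where `s`
is the value of a word that labels a path starting at `g` in `Δ`. -/
def schutzenbergerClosure (ι : X → S) : ClosureOperator (CSub (groupGen ι)) :=
  .ofPred (fun Δ => CSub.directedUnion _ (hS.directed_smul_schutzenbergerCSub Δ))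
    (IsClosedGraph ι)
    (fun _ => CSub.le_iff_forall_pathGraph_le.2 fun g w hw =>
      CSub.pathGraph_le_directedUnion_iff.2 ⟨⟨(g, w), hw⟩,
        ((hS.isClosedGraph_schutzenbergerCSub ι _).smul g).smul_schutzenbergerCSub_le_iff.1 le_rfl⟩)
    (fun _ => isClosedGraph_directedUnion fun p =>
      (hS.isClosedGraph_schutzenbergerCSub ι _).smul p.1.1)
    (fun _ _ hle hΞ => CSub.directedUnion_le fun p =>
      hΞ.smul_schutzenbergerCSub_le_iff.2 (p.2.trans hle))

theorem schutzenbergerClosure_eq_self_iff {Δ : CSub (groupGen ι)} :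
    schutzenbergerClosure hS ι Δ = Δ ↔ IsClosedGraph ι Δ :=
  (schutzenbergerClosure hS ι).isClosed_iff.symm

theorem IsCompactGraph.isClosedGraph {Δ : CSub (groupGen ι)}
    (hΔ : IsCompactGraph (schutzenbergerClosure hS ι) Δ) : IsClosedGraph ι Δ :=
  (schutzenbergerClosure_eq_self_iff hS).1 hΔ.closed

theorem schutzenbergerClosure_pathGraph (g : GroupImage S) (w : List (X × Bool)) :
    schutzenbergerClosure hS ι (CSub.pathGraph (groupGen ι) g w) =
      g • schutzenbergerCSub ι (wordVal ι w) := by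
  have closed := (hS.isClosedGraph_schutzenbergerCSub ι (wordVal ι w)).smul g
  refine le_antisymm (ClosureOperator.closure_min ?_ closed) ?_
  · exact closed.smul_schutzenbergerCSub_le_iff.1 le_rfl
  · exact ((schutzenbergerClosure hS ι).isClosed_closure
      _ : IsClosedGraph ι _).smul_schutzenbergerCSub_le_iff.2
        ((schutzenbergerClosure hS ι).le_closure _)

theorem gInvariant_schutzenbergerClosure (ι : X → S) : GInvariant (schutzenbergerClosure hS ι) :=
  gInvariant_of_isClosed_smul fun g _ hΔ => IsClosedGraph.smul hΔ g

theorem isFinitary_schutzenbergerClosure (ι : X → S) : IsFinitary (schutzenbergerClosure hS ι) := by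
  refine isFinitary_of_pathGraph_le_closure fun {Δ g w} hw => ?_
  obtain ⟨⟨⟨h, u⟩, hu⟩, hle⟩ := CSub.pathGraph_le_directedUnion_iff
    (hΦ := hS.directed_smul_schutzenbergerCSub Δ).1 hw
  exact ⟨_, CayleySubgraph.isFinite_pathGraph h u, hu,
    hle.trans_eq (schutzenbergerClosure_pathGraph hS h u).symm⟩

theorem schutzenbergerClosure_pathGraph_one (w : List (X × Bool)) :
    schutzenbergerClosure hS ι (CSub.pathGraph (groupGen ι) 1 w) =
      schutzenbergerCSub ι (wordVal ι w) := by
  rw [schutzenbergerClosure_pathGraph, one_smul]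

/-! ### The isomorphism onto `S_c` -/

theorem IsEUnitary.mul_inv_mul_eq_of_schutzenbergerCSub_le (hS : IsEUnitary S)
    (hι : IsGeneratedBy ι) {s t : S}
    (hle : schutzenbergerCSub ι s ≤ schutzenbergerCSub ι t)
    (hσ : toGroupImage S s = toGroupImage S t) : t * t⁻¹ * s = t := by
  obtain ⟨w, rfl⟩ := hι.exists_word s
  obtain ⟨x, hx, htx, htxs⟩ := hS.pathGraph_le_schutzenbergerCSub_iff.1
    ((pathGraph_one_le_schutzenbergerCSub ι w).trans hle)
  obtain rfl : t * t⁻¹ = x := by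
    refine hS.eq_of_mul_inv_eq ?_ ?_
    · exact (InverseMonoid.mul_mul_inv_eq_of_mul_mul_eq (InverseMonoid.mul_inv_mul t)).trans
        htx.mul_inv_eq
    · rw [hx, map_mul, toGroupImage_inv, mul_inv_cancel]
  refine hS.eq_of_mul_inv_eq htxs.mul_inv_eq.symm ?_
  rw [map_mul, hx, hσ, one_mul]

variable (hι : IsGeneratedBy ι)

/-- The map `s ↦ (SΓ(s), σ♯(s))` from `S` to `S_c`. -/
def toClosureMonoid (s : S) :
    ClosureMonoid (schutzenbergerClosure hS ι) (gInvariant_schutzenbergerClosure hS ι) where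
  graph := schutzenbergerCSub ι s
  elt := toGroupImage S s
  compact := by
    obtain ⟨w, rfl⟩ := hι.exists_word s
    rw [← schutzenbergerClosure_pathGraph_one hS]
    exact isCompactGraph_closure_pathGraph 1 w
  one_mem := by
    obtain ⟨w, rfl⟩ := hι.exists_word s
    exact CSub.start_mem_of_pathGraph_le (pathGraph_one_le_schutzenbergerCSub ι w)
  elt_mem := ⟨s, .refl ι s, rfl⟩

theorem toClosureMonoid_mul (s t : S) :
    toClosureMonoid hS hι (s * t) = toClosureMonoid hS hι s * toClosureMonoid hS hι t := by
  refine ClosureMonoid.eq_of (map_mul _ _ _) fun Ω hΩ => ?_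
  obtain ⟨w, rfl⟩ := hι.exists_word s
  obtain ⟨u, rfl⟩ := hι.exists_word t
  have closed := hΩ.isClosedGraph hS
  have path_append :=
    CSub.pathGraph_append_le_iff (ι := groupGen ι) (g := 1) (w := w) (w' := u) (Δ := Ω)
  rw [ClosureMonoid.mul_le_iff hΩ, ← wordVal_append]
  rwa [one_mul, ← closed.schutzenbergerCSub_le_iff, ← closed.schutzenbergerCSub_le_iff,
    ← toGroupImage_wordVal, ← closed.smul_schutzenbergerCSub_le_iff] at path_append

theorem toClosureMonoid_injective : Function.Injective (toClosureMonoid hS hι) := by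
  intro s t hst
  have hσ : toGroupImage S s = toGroupImage S t := congrArg ClosureMonoid.elt hst
  exact InverseMonoid.eq_of_mul_inv_mul_eq
    (hS.mul_inv_mul_eq_of_schutzenbergerCSub_le hι (ClosureMonoid.graph_le_of_eq hst.symm) hσ.symm)
    (hS.mul_inv_mul_eq_of_schutzenbergerCSub_le hι (ClosureMonoid.graph_le_of_eq hst) hσ)

theorem toClosureMonoid_surjective : Function.Surjective (toClosureMonoid hS hι) := by
  intro p
  obtain ⟨w, hw⟩ := p.compact.exists_pathGraph p.one_mem
  have hwp := ((schutzenbergerClosure hS ι).le_closure _).trans hw.le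
  obtain ⟨u, hu, helt⟩ := CSub.exists_pathGraph_append_le hwp p.elt_mem
  refine ⟨wordVal ι (w ++ u), ClosureMonoid.ext ?_ ?_⟩
  · refine (schutzenbergerClosure_pathGraph_one hS (w ++ u)).symm.trans
      (le_antisymm (p.compact.closure_le hu) (hw.ge.trans ?_))
    exact (schutzenbergerClosure hS ι).monotone (CSub.pathGraph_append_le_iff.1 le_rfl).1
  · rw [← helt, one_mul, ← toGroupImage_wordVal]
    rfl

/-- The isomorphism `s ↦ (SΓ(s), σ♯(s))` from `S` onto `S_c`. -/
noncomputable def closureMonoidEquiv :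
    S ≃* ClosureMonoid (schutzenbergerClosure hS ι) (gInvariant_schutzenbergerClosure hS ι) :=
  { Equiv.ofBijective _ ⟨toClosureMonoid_injective hS hι, toClosureMonoid_surjective hS hι⟩ with
    map_mul' := toClosureMonoid_mul hS hι }

end SchutzenbergerClosure

/-! ### `S_c` as a `P`-semigroup -/

theorem PSemigroup.isGLB_mul {G 𝒳 : Type*} [Group G] [PartialOrder 𝒳] [MulAction G 𝒳] {𝒴 : Set 𝒳}
    {hT : IsMcAlisterTriple G 𝒴} (p q : PSemigroup hT) :
    IsGLB {p.fst, p.snd • q.fst} (p * q).fst :=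
  (hT.exists_isGLB p q).choose_spec

section CompactGraphs

variable {X G : Type*} [Group G] {ι : X → G} {c : ClosureOperator (CSub ι)} {hc : GInvariant c}

theorem ClosureMonoid.mul_self_of_elt_eq_one {p : ClosureMonoid c hc} (h : p.elt = 1) :
    p * p = p := by
  refine eq_of (by rw [mul_elt, h, mul_one]) fun Ω hΩ => ?_
  rw [mul_le_iff hΩ, h, one_smul, and_self]

/-- The second projection, from `S_c` to the group. -/
def ClosureMonoid.eltHom (c : ClosureOperator (CSub ι)) (hc : GInvariant c) :
    ClosureMonoid c hc →* G where
  toFun := elt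
  map_one' := rfl
  map_mul' _ _ := rfl

theorem ClosureMonoid.isEUnitary (c : ClosureOperator (CSub ι)) (hc : GInvariant c) :
    IsEUnitary (ClosureMonoid c hc) :=
  .of_monoidHom (eltHom c hc) fun _ => mul_self_of_elt_eq_one

theorem isGLB_union {Δ Ξ M : CompactGraphs c hc} {v : G} (hΔ : v ∈ Δ.graph.1.verts)
    (hΞ : v ∈ Ξ.graph.1.verts) (hM : M.graph = c (Δ.graph.union Ξ.graph v hΔ hΞ)) :
    IsGLB {Δ, Ξ} M := by
  constructor
  · rintro _ (rfl | rfl)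
    · exact ((CSub.left_le _ _ _ _ _).trans (c.le_closure _)).trans_eq hM.symm
    · exact ((CSub.right_le _ _ _ _ _).trans (c.le_closure _)).trans_eq hM.symm
  · intro Ω hΩ
    exact hM.trans_le (Ω.compact.closure_le
      (CSub.union_le (hΩ (Set.mem_insert _ _)) (hΩ (Set.mem_insert_of_mem _ rfl))))

theorem exists_isGLB_compactGraphsOne (Δ Ξ : CompactGraphs c hc)
    (hΔ : Δ ∈ compactGraphsOne c hc) (hΞ : Ξ ∈ compactGraphsOne c hc) :
    ∃ M ∈ compactGraphsOne c hc, IsGLB {Δ, Ξ} M ∧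
      M.graph = c (Δ.graph.union Ξ.graph 1 hΔ hΞ) :=
  ⟨⟨_, Δ.compact.union Ξ.compact hΔ hΞ⟩, (c.le_closure _).1 (Or.inl hΔ), isGLB_union hΔ hΞ rfl,
    rfl⟩

theorem inv_smul_mem_compactGraphsOne_iff {Δ : CompactGraphs c hc} {g : G} :
    g⁻¹ • Δ ∈ compactGraphsOne c hc ↔ g ∈ Δ.graph.1.verts := by
  change 1 ∈ (g⁻¹ • Δ.graph).1.verts ↔ _
  rw [CSub.mem_smul, inv_inv, mul_one]

theorem isMcAlisterTriple_compactGraphs (hι : IsGeneratedBy ι) :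
    IsMcAlisterTriple G (compactGraphsOne c hc) where
  smul_le_smul _ _ _ h := CSub.smul_le h
  isLowerSet _ _ hle h := hle.1 h
  exists_meet := by
    rintro ⟨Δ, hΔ⟩ ⟨Ξ, hΞ⟩
    obtain ⟨M, hM, hglb, -⟩ := exists_isGLB_compactGraphsOne Δ Ξ hΔ hΞ
    refine ⟨⟨M, hM⟩, IsGLB.of_image (f := Subtype.val) Iff.rfl ?_⟩
    rwa [Set.image_pair]
  exists_smul_eq Δ := by
    obtain ⟨g, hg⟩ := Δ.graph.2.1
    exact ⟨g, g⁻¹ • Δ, inv_smul_mem_compactGraphsOne_iff.2 hg, smul_inv_smul g Δ⟩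
  exists_smul_mem g := by
    let _ := InverseMonoid.ofGroup G
    obtain ⟨w, hw⟩ := hι.exists_word g⁻¹
    have hle := c.le_closure (CSub.pathGraph ι 1 w)
    refine ⟨⟨_, isCompactGraph_closure_pathGraph 1 w⟩, CSub.start_mem_of_pathGraph_le hle, ?_⟩
    rw [← inv_inv g, inv_smul_mem_compactGraphsOne_iff, ← hw, ← one_mul (wordVal ι w)]
    exact CSub.end_mem_of_pathGraph_le hle

/-- The identity map on pairs, from `S_c` to the `P`-semigroup of compact graphs. -/
noncomputable def closureMonoidEquivPSemigroup (hT : IsMcAlisterTriple G (compactGraphsOne c hc)) :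
    ClosureMonoid c hc ≃* PSemigroup hT where
  toFun p :=
    { fst := ⟨p.graph, p.compact⟩
      snd := p.elt
      mem := ⟨⟨_, inv_smul_mem_compactGraphsOne_iff.2 p.elt_mem, smul_inv_smul _ _⟩, p.one_mem⟩ }
  invFun q :=
    { graph := q.fst.graph
      elt := q.snd
      compact := q.fst.compact
      one_mem := q.mem.2
      elt_mem := by
        obtain ⟨⟨Δ, hΔ, hfst⟩, -⟩ := q.mem
        rwa [← inv_smul_mem_compactGraphsOne_iff, ← hfst, inv_smul_smul] }
  left_inv _ := rfl
  right_inv _ := rfl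
  map_mul' p q := PSemigroup.ext
    ((isGLB_union p.elt_mem (ClosureMonoid.mem_smul_graph p q) rfl).unique
      (PSemigroup.isGLB_mul _ _)) rfl

end CompactGraphs

theorem mainTheorem8_general :
    (∀ (S : Type u) [InverseMonoid S], IsEUnitary S →
      ∃ (G : Type u) (_ : Group G) (𝒳 : Type u) (_ : PartialOrder 𝒳) (_ : MulAction G 𝒳)
        (𝒴 : Set 𝒳) (hT : IsMcAlisterTriple G 𝒴), Nonempty (S ≃* PSemigroup hT)) ∧
    (∀ (S : Type u) [InverseMonoid S], IsEUnitary S →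
      ∀ (X : Type v) (ι : X → S), IsGeneratedBy ι →
      ∃ (c : ClosureOperator (CSub (groupGen ι))) (hc : GInvariant c),
        IsFinitary c ∧ (∀ Δ, c Δ = Δ ↔ IsClosedGraph ι Δ) ∧
        (∃ ψ : S ≃* ClosureMonoid c hc, ∀ s,
          (ψ s).graph.1 = schutzenbergerGraph ι s ∧ (ψ s).elt = toGroupImage S s) ∧
        ∃ (hT : IsMcAlisterTriple (GroupImage S) (compactGraphsOne c hc))
          (θ : S ≃* PSemigroup hT), ∀ s,
          (θ s).fst.graph.1 = schutzenbergerGraph ι s ∧ (θ s).snd = toGroupImage S s) ∧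
    (∀ (G : Type u) [Group G] (X : Type v) (ι : X → G), IsGeneratedBy ι →
      ∀ (c : ClosureOperator (CSub ι)) (hc : GInvariant c),
        IsEUnitary (ClosureMonoid c hc) ∧
        ∃ hT : IsMcAlisterTriple G (compactGraphsOne c hc),
          (∀ (Δ Ξ : CompactGraphs c hc) (hΔ : Δ ∈ compactGraphsOne c hc)
            (hΞ : Ξ ∈ compactGraphsOne c hc),
            ∃ M ∈ compactGraphsOne c hc, IsGLB {Δ, Ξ} M ∧
              M.graph = c (Δ.graph.union Ξ.graph 1 hΔ hΞ)) ∧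
          ∃ φ : ClosureMonoid c hc ≃* PSemigroup hT, ∀ p,
            (φ p).fst.graph = p.graph ∧ (φ p).snd = p.elt) := by
  refine ⟨fun S _ hS => ?_, fun S _ hS X ι hι => ?_, fun G _ X ι hι c hc => ?_⟩
  · have hι : IsGeneratedBy (id : S → S) := fun T hT _ => eq_top_iff.2 fun s _ => hT s
    exact ⟨GroupImage S, inferInstance, _, inferInstance, inferInstance, _,
      isMcAlisterTriple_compactGraphs hι.groupGen,
      ⟨(closureMonoidEquiv hS hι).trans (closureMonoidEquivPSemigroup _)⟩⟩
  · exact ⟨schutzenbergerClosure hS ι, gInvariant_schutzenbergerClosure hS ι,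
      isFinitary_schutzenbergerClosure hS ι, fun _ => schutzenbergerClosure_eq_self_iff hS,
      ⟨closureMonoidEquiv hS hι, fun _ => ⟨rfl, rfl⟩⟩,
      isMcAlisterTriple_compactGraphs hι.groupGen,
      (closureMonoidEquiv hS hι).trans (closureMonoidEquivPSemigroup _), fun _ => ⟨rfl, rfl⟩⟩
  · exact ⟨ClosureMonoid.isEUnitary c hc, isMcAlisterTriple_compactGraphs hι,
      exists_isGLB_compactGraphsOne, closureMonoidEquivPSemigroup _, fun _ => ⟨rfl, rfl⟩⟩

theorem mainTheorem8 :
    -- every E-unitary inverse monoid is isomorphic to a P-semigroup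
    (∀ (S : Type u) [InverseMonoid S], IsEUnitary S →
      ∃ (G : Type u) (_ : Group G) (𝒳 : Type u) (_ : PartialOrder 𝒳) (_ : MulAction G 𝒳)
        (𝒴 : Set 𝒳) (hT : IsMcAlisterTriple G 𝒴), Nonempty (S ≃* PSemigroup hT)) ∧
    -- an X-generated E-unitary inverse monoid S is isomorphic to S_c for c = c_S,
    -- and hence to the P-semigroup of compact subgraphs
    (∀ (S : Type u) [InverseMonoid S], IsEUnitary S →
      ∀ (X : Type v) (ι : X → S), IsGeneratedBy ι →
      ∃ (c : ClosureOperator (CSub (groupGen ι))) (hc : GInvariant c),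
        IsFinitary c ∧ (∀ Δ, c Δ = Δ ↔ IsClosedGraph ι Δ) ∧
        (∃ ψ : S ≃* ClosureMonoid c hc, ∀ s,
          (ψ s).graph.1 = schutzenbergerGraph ι s ∧ (ψ s).elt = toGroupImage S s) ∧
        ∃ (hT : IsMcAlisterTriple (GroupImage S) (compactGraphsOne c hc))
          (θ : S ≃* PSemigroup hT), ∀ s,
          (θ s).fst.graph.1 = schutzenbergerGraph ι s ∧ (θ s).snd = toGroupImage S s) ∧
    -- S_c is the P-semigroup of (G, 𝒴, 𝒳), with 𝒳 the compact subgraphs under reverse inclusion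
    (∀ (G : Type u) [Group G] (X : Type v) (ι : X → G), IsGeneratedBy ι →
      ∀ (c : ClosureOperator (CSub ι)) (hc : GInvariant c), IsFinitary c →
        IsEUnitary (ClosureMonoid c hc) ∧
        ∃ hT : IsMcAlisterTriple G (compactGraphsOne c hc),
          (∀ (Δ Ξ : CompactGraphs c hc) (hΔ : Δ ∈ compactGraphsOne c hc)
            (hΞ : Ξ ∈ compactGraphsOne c hc),
            ∃ M ∈ compactGraphsOne c hc, IsGLB {Δ, Ξ} M ∧
              M.graph = c (Δ.graph.union Ξ.graph 1 hΔ hΞ)) ∧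
          ∃ φ : ClosureMonoid c hc ≃* PSemigroup hT, ∀ p,
            (φ p).fst.graph = p.graph ∧ (φ p).snd = p.elt) := by
  obtain ⟨pTheorem, schutzenberger, closureMonoid⟩ := mainTheorem8_general.{u, v}
  exact ⟨pTheorem, schutzenberger, fun G _ X ι hι c hc _ => closureMonoid G X ι hι c hc⟩
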